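/- **Conventions.** Identify rational numbers, pairs of rational numbers and finite binary strings with natural numbers in a standard effective way. For $A\subseteq\mathbb N$ let $W_e^A$ denote the $e$-th set that is computably enumerable in $A$, let $A'=\{e : e\in W_e^A\}$ be the Turing jump of $A$, and let $\emptyset^{(0)}=\emptyset$, $\emptyset^{(n+1)}=(\emptyset^{(n)})'$. The $\Sigma^{0,A}_1$ class in $[0,1]$ with index $e$ is $\bigcup\{(a,b)\cap[0,1] : a,b\in\mathbb Q,\ (a,b)\in W_e^A\}$, and a $\Pi^{0,A}_1$ class is the complement in $[0,1]$ of a $\Sigma^{0,A}_1$ class. A real $x\in[0,1]$ is *1-generic relative to $A$* if $x\notin V\setminus\mathrm{Int}(V)$ for every $\Pi^{0,A}_1$ class $V\subseteq[0,1]$, the interior being taken in the space $[0,1]$. For $n\ge 1$, $x\in[0,1]$ is *$n$-generic* if $x\notin V\setminus\mathrm{Int}(V)$ for every $\Pi^{0,\emptyset^{(n-1)}}_1$ class $V\subseteq[0,1]$. A function $f:[0,1]\to\mathbb R$ is *$A$-computable* if there is an $A$-computable function $\alpha:\mathbb Q\times\mathbb Q\to\mathbb N$ such that, for all $q,r\in\mathbb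 Q$, the set $f^{-1}((q,r))$ is the $\Sigma^{0,A}_1$ class with index $\alpha(q,r)$. It is *differentiable* if it is differentiable at every point of $[0,1]$ in the classical sense (one-sided at the endpoints). **Theorem.** 1. Let $A\subseteq\mathbb N$ and $x\in[0,1]$. Then $x$ is 1-generic relative to $A$ if and only if for every differentiable $A$-computable function $f:[0,1]\to\mathbb R$, the derivative $f':[0,1]\to\mathbb R$ is continuous at $x$. 2. Let $n\ge 1$ and $x\in[0,1]$. Then $x$ is $n$-generic if and only if for every differentiable $\emptyset^{(n-1)}$-computable function $f:[0,1]\to\mathbb R$, the derivative $f':[0,1]\to\mathbb R$ is continuous at $x$. -/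

import Mathlib

/-! Computability relative to an oracle `A ⊆ ℕ`. -/

/-- The characteristic function of `A`, as an oracle for `ComputableIn` and `Nat.RecursiveIn`. -/
noncomputable def oracleOf (A : Set ℕ) : ℕ →. ℕ :=
  open Classical in fun n => Part.some (if n ∈ A then 1 else 0)

/-- The initial segment `A ↾ k` of the characteristic sequence of `A`, as a finite binary string. -/
noncomputable def initSeg (A : Set ℕ) (k : ℕ) : List Bool :=
  open Classical in (List.range k).map fun i => decide (i ∈ A)

/-- `W_e^A`, the `e`-th set that is computably enumerable in `A`: the number `x` belongs to it when
the `e`-th Turing program halts on `x` together with some finite part `A ↾ k` of the oracle. -/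
def ceSet (A : Set ℕ) (e : ℕ) : Set ℕ :=
  {x | ∃ k : ℕ, (Nat.Partrec.Code.eval (Denumerable.ofNat Nat.Partrec.Code e)
    (Encodable.encode (initSeg A k, x))).Dom}

/-- The Turing jump `A' = {e | e ∈ W_e^A}`, the halting set relative to `A`. -/
def turingJump (A : Set ℕ) : Set ℕ :=
  {e | e ∈ ceSet A e}

/-- `∅^(n)`, the `n`-th jump of the empty set; `∅^(0) = ∅`. -/
def jumpEmpty (n : ℕ) : Set ℕ :=
  turingJump^[n] ∅

/-! Effectively open and effectively closed subsets of `[0,1]`. -/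

/-- The code of a rational number, from its numerator (positive and negative part) and denominator
in lowest terms. -/
def ratCode (q : ℚ) : ℕ :=
  Nat.pair (Nat.pair q.num.toNat (-q.num).toNat) q.den

/-- The code of the pair `(a, b)`, that is, of the rational interval with these endpoints. -/
def ratPairCode (a b : ℚ) : ℕ :=
  Nat.pair (ratCode a) (ratCode b)

/-- The rational interval `(a, b)`, as a basic open subset of `[0,1]`. -/
def basicOpen (a b : ℚ) : Set unitInterval :=
  {t | (a : ℝ) < (t : ℝ) ∧ (t : ℝ) < (b : ℝ)}

/-- The `Σ⁰₁(A)` class in `[0,1]` with index `e`: the union of the basic open sets whose codes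
lie in `W_e^A`. -/
def sigmaClass (A : Set ℕ) (e : ℕ) : Set unitInterval :=
  {t | ∃ a b : ℚ, ratPairCode a b ∈ ceSet A e ∧ t ∈ basicOpen a b}

/-- `V` is a `Π⁰₁(A)` class in `[0,1]`. -/
def IsPiClass (A : Set ℕ) (V : Set unitInterval) : Prop :=
  ∃ e : ℕ, Vᶜ = sigmaClass A e

/-- `x ∈ [0,1]` is 1-generic relative to `A`. The interior is taken in the space `[0,1]`. -/
def IsOneGenericIn (A : Set ℕ) (x : unitInterval) : Prop :=
  ∀ V : Set unitInterval, IsPiClass A V → x ∉ V \ interior V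

/-- `x ∈ [0,1]` is `n`-generic, for `n ≥ 1`. -/
def IsNGeneric (n : ℕ) (x : unitInterval) : Prop :=
  ∀ V : Set unitInterval, IsPiClass (jumpEmpty (n - 1)) V → x ∉ V \ interior V

/-! Functions `f : [0,1] → ℝ`. -/

/-- `f` is `A`-computable: an index of the `Σ⁰₁(A)` class `f⁻¹((q, r))` can be computed from the
rational numbers `q` and `r` with the help of `A`. -/
def IsComputableFunIn (A : Set ℕ) (f : unitInterval → ℝ) : Prop :=
  ∃ α : ℕ → ℕ, ComputableIn {oracleOf A} α ∧
    ∀ q r : ℚ, f ⁻¹' Set.Ioo (q : ℝ) (r : ℝ) = sigmaClass A (α (ratPairCode q r))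

/-- `f` is differentiable on `[0,1]` with derivative `f'` (one-sided at the endpoints). The function
`Set.IccExtend` only serves to regard `f` as a function on `ℝ`; its values outside `[0,1]` play
no role in `HasDerivWithinAt`. -/
def HasDerivOnUnit (f f' : unitInterval → ℝ) : Prop :=
  ∀ t : unitInterval,
    HasDerivWithinAt (Set.IccExtend (zero_le_one' ℝ) f) (f' t) (Set.Icc 0 1) (t : ℝ)

/-! The sets `W_e^A` agree with Mathlib's notion of oracle computability: the last theorem of this
section. -/

namespace OracleUse

theorem mem_rfind' {p : ℕ → Part Bool} {n : ℕ} :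
    n ∈ Nat.rfind p ↔ true ∈ p n ∧ ∀ m, m < n → false ∈ p m := by
  have := Nat.mem_rfind (p := p) (n := n)
  exact ⟨fun h => ⟨(this.1 h).1, fun m hm => (this.1 h).2 hm⟩, fun h => this.2 ⟨h.1, fun {m} hm => h.2 m hm⟩⟩

theorem mem_bind' {a : Part ℕ} {f : ℕ →. ℕ} {y : ℕ} : y ∈ (a >>= f) ↔ ∃ b ∈ a, y ∈ f b :=
  Part.mem_bind_iff


theorem initSeg_prefix (A : Set ℕ) {k l : ℕ} (h : k ≤ l) : initSeg A k <+: initSeg A l := by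
  unfold initSeg
  obtain ⟨d, rfl⟩ := Nat.exists_eq_add_of_le h
  rw [List.range_add, List.map_append]
  exact List.prefix_append _ _

/-- The use principle: a computation with oracle `A` uses only a finite part of `A`. -/
theorem use_principle (A : Set ℕ) {f : ℕ →. ℕ} (hf : Nat.RecursiveIn {oracleOf A} f) :
    ∃ F : List Bool → ℕ →. ℕ, Partrec₂ F ∧
      (∀ σ τ x y, σ <+: τ → y ∈ F σ x → y ∈ F τ x) ∧
      ∀ x y, y ∈ f x ↔ ∃ k, y ∈ F (initSeg A k) x := by
  classical
  induction hf with
  | zero => exact ⟨fun _ _ => pure 0, (Computable.const 0).partrec, by simp, fun x y => ⟨fun h => ⟨0, h⟩, fun ⟨_, h⟩ => h⟩⟩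
  | succ =>
    exact ⟨fun _ x => pure (x+1), (Computable.succ.comp Computable.snd).partrec, by simp,
      by intro x y; simp [PFun.coe_val]⟩
  | left =>
    exact ⟨fun _ x => pure x.unpair.1,
      (Computable.fst.comp (Computable.unpair.comp Computable.snd)).partrec, by simp, by simp⟩
  | right =>
    exact ⟨fun _ x => pure x.unpair.2,
      (Computable.snd.comp (Computable.unpair.comp Computable.snd)).partrec, by simp, by simp⟩
  | oracle g hg =>
    obtain rfl : g = oracleOf A := hg
    refine ⟨fun σ x => ((σ[x]?).map (fun b => cond b 1 0) : Option ℕ), ?_, ?_, ?_⟩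
    · refine Computable.ofOption ?_
      exact Computable.option_map (Computable.list_getElem?.comp Computable.fst Computable.snd)
        (Computable.cond Computable.snd (Computable.const 1) (Computable.const 0)).to₂
    · rintro σ _ x y ⟨τ, rfl⟩ h
      simp only [Part.mem_coe, Option.mem_def, Option.map_eq_some_iff] at h ⊢
      obtain ⟨b, hb, rfl⟩ := h
      exact ⟨b, by rw [List.getElem?_append_left]; exact hb
                   exact (List.getElem?_eq_some_iff.1 hb).1, rfl⟩
    · intro x y
      simp only [oracleOf, Part.mem_some_iff, Part.mem_coe, Option.mem_def, Option.map_eq_some_iff]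
      constructor
      · rintro rfl
        refine ⟨x+1, decide (x ∈ A), by simp [initSeg], ?_⟩
        by_cases h : x ∈ A <;> simp [h]
      · rintro ⟨k, b, hb, rfl⟩
        simp only [initSeg, List.getElem?_map, Option.map_eq_some_iff] at hb
        obtain ⟨i, hi, rfl⟩ := hb
        obtain ⟨h1, h2⟩ := List.getElem?_eq_some_iff.1 hi
        simp at h2; subst h2
        by_cases h : x ∈ A <;> simp [h]
  | @pair f h _ _ ihf ihh =>
    obtain ⟨F, hF, mF, cF⟩ := ihf
    obtain ⟨H, hH, mH, cH⟩ := ihh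
    refine ⟨fun σ x => (F σ x).bind fun a => (H σ x).map fun b => Nat.pair a b, ?_, ?_, ?_⟩
    · refine Partrec.bind hF (Partrec.map (hH.comp (Computable.fst.comp Computable.fst) (Computable.snd.comp Computable.fst)) ?_)
      exact (Primrec₂.natPair.to_comp.comp (Computable.snd.comp Computable.fst) Computable.snd)
    · intro σ τ x y h
      simp only [Part.mem_bind_iff, Part.mem_map_iff]
      rintro ⟨a, ha, b, hb, rfl⟩
      exact ⟨a, mF _ _ _ _ h ha, b, mH _ _ _ _ h hb, rfl⟩
    · intro x y
      simp only [Seq.seq, Part.mem_bind_iff, Part.mem_map_iff, Part.map_eq_map]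
      constructor
      · rintro ⟨_, ⟨a, ha, rfl⟩, b, hb, rfl⟩
        obtain ⟨k, hk⟩ := (cF _ _).1 ha
        obtain ⟨l, hl⟩ := (cH _ _).1 hb
        exact ⟨max k l, a, mF _ _ _ _ (initSeg_prefix A (le_max_left _ _)) hk, b,
          mH _ _ _ _ (initSeg_prefix A (le_max_right _ _)) hl, rfl⟩
      · rintro ⟨k, a, ha, b, hb, rfl⟩
        exact ⟨_, ⟨a, (cF _ _).2 ⟨k, ha⟩, rfl⟩, b, (cH _ _).2 ⟨k, hb⟩, rfl⟩
  | @comp f h _ _ ihf ihh =>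
    obtain ⟨F, hF, mF, cF⟩ := ihf
    obtain ⟨H, hH, mH, cH⟩ := ihh
    refine ⟨fun σ x => (H σ x).bind fun a => F σ a, ?_, ?_, ?_⟩
    · exact Partrec.bind hH (hF.comp (Computable.fst.comp Computable.fst) Computable.snd)
    · intro σ τ x y h
      simp only [Part.mem_bind_iff]
      rintro ⟨a, ha, hb⟩
      exact ⟨a, mH _ _ _ _ h ha, mF _ _ _ _ h hb⟩
    · intro x y
      simp only [mem_bind', Part.mem_bind_iff]
      constructor
      · rintro ⟨a, ha, hb⟩
        obtain ⟨k, hk⟩ := (cH _ _).1 ha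
        obtain ⟨l, hl⟩ := (cF _ _).1 hb
        exact ⟨max k l, a, mH _ _ _ _ (initSeg_prefix A (le_max_left _ _)) hk,
          mF _ _ _ _ (initSeg_prefix A (le_max_right _ _)) hl⟩
      · rintro ⟨k, a, ha, hb⟩
        exact ⟨a, (cH _ _).2 ⟨k, ha⟩, (cF _ _).2 ⟨k, hb⟩⟩
  | @prec f h _ _ ihf ihh =>
    obtain ⟨F, hF, mF, cF⟩ := ihf
    obtain ⟨H, hH, mH, cH⟩ := ihh
    refine ⟨fun σ p => (p.unpair.2).rec (F σ p.unpair.1) fun y IH => IH.bind fun i =>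
      H σ (Nat.pair p.unpair.1 (Nat.pair y i)), ?_, ?_, ?_⟩
    · refine Partrec.nat_rec (f := fun q : List Bool × ℕ => q.2.unpair.2)
        (g := fun q => F q.1 q.2.unpair.1)
        (h := fun q (z : ℕ × ℕ) => H q.1 (Nat.pair q.2.unpair.1 (Nat.pair z.1 z.2))) ?_ ?_ ?_
      · exact (Computable.snd.comp (Computable.unpair.comp Computable.snd))
      · exact hF.comp Computable.fst (Computable.fst.comp (Computable.unpair.comp Computable.snd))
      · refine hH.comp (Computable.fst.comp Computable.fst) ?_
        refine Primrec₂.natPair.to_comp.comp (Computable.fst.comp (Computable.unpair.comp (Computable.snd.comp Computable.fst))) ?_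
        exact Primrec₂.natPair.to_comp.comp (Computable.fst.comp Computable.snd) (Computable.snd.comp Computable.snd)
    · intro σ τ x y h
      dsimp only
      generalize x.unpair.1 = a
      generalize x.unpair.2 = n
      induction n generalizing y with
      | zero => exact mF _ _ _ _ h
      | succ n ih =>
        simp only [Part.mem_bind_iff]
        rintro ⟨i, hi, hy⟩
        exact ⟨i, ih _ hi, mH _ _ _ _ h hy⟩
    · intro x y
      dsimp only
      have mono : ∀ σ τ a n y, σ <+: τ →
        y ∈ (Nat.rec (motive := fun _ => Part ℕ) (F σ a) (fun y IH => IH.bind fun i => H σ (Nat.pair a (Nat.pair y i))) n : Part ℕ) →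
        y ∈ (Nat.rec (motive := fun _ => Part ℕ) (F τ a) (fun y IH => IH.bind fun i => H τ (Nat.pair a (Nat.pair y i))) n : Part ℕ) := by
        intro σ τ a n y h
        induction n generalizing y with
        | zero => exact mF _ _ _ _ h
        | succ n ih =>
          simp only [Part.mem_bind_iff]
          rintro ⟨i, hi, hy⟩
          exact ⟨i, ih _ hi, mH _ _ _ _ h hy⟩
      generalize x.unpair.1 = a
      generalize x.unpair.2 = n
      induction n generalizing y with
      | zero => exact cF _ _
      | succ n ih =>
        simp only [Part.bind_eq_bind, Part.mem_bind_iff]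
        constructor
        · rintro ⟨i, hi, hb⟩
          obtain ⟨k, hk⟩ := (ih _).1 hi
          obtain ⟨l, hl⟩ := (cH _ _).1 hb
          exact ⟨max k l, i, mono _ _ _ _ _ (initSeg_prefix A (le_max_left _ _)) hk,
            mH _ _ _ _ (initSeg_prefix A (le_max_right _ _)) hl⟩
        · rintro ⟨k, i, hi, hb⟩
          exact ⟨i, (ih _).2 ⟨k, hi⟩, (cH _ _).2 ⟨k, hb⟩⟩
  | @rfind f _ ihf =>
    obtain ⟨F, hF, mF, cF⟩ := ihf
    refine ⟨fun σ a => Nat.rfind fun n => (F σ (Nat.pair a n)).map fun m => decide (m = 0), ?_, ?_, ?_⟩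
    · refine Partrec.rfind (p := fun (q : List Bool × ℕ) n => (F q.1 (Nat.pair q.2 n)).map fun m => decide (m = 0)) ?_
      refine Partrec.map (hF.comp (Computable.fst.comp Computable.fst) (Primrec₂.natPair.to_comp.comp (Computable.snd.comp Computable.fst) Computable.snd)) ?_
      exact ((Primrec.eq.comp Primrec.snd (Primrec.const 0)).decide : Primrec fun q : ((List Bool × ℕ) × ℕ) × ℕ => decide (q.2 = 0)).to_comp
    · intro σ τ x y h
      simp only [mem_rfind', Part.mem_map_iff]
      rintro ⟨⟨m, hm, e⟩, h2⟩
      refine ⟨⟨m, mF _ _ _ _ h hm, e⟩, fun j hj => ?_⟩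
      obtain ⟨m', hm', e'⟩ := h2 j hj
      exact ⟨m', mF _ _ _ _ h hm', e'⟩
    · intro x y
      simp only [mem_rfind', Part.mem_map_iff, Part.map_eq_map]
      constructor
      · rintro ⟨⟨m, hm, e⟩, h2⟩
        obtain ⟨k, hk⟩ := (cF _ _).1 hm
        have : ∀ j, ∃ k, j < y → ∃ a ∈ F (initSeg A k) (Nat.pair x j), decide (a = 0) = false := by
          intro j
          by_cases hj : j < y
          · obtain ⟨m', hm', e'⟩ := h2 j hj
            obtain ⟨l, hl⟩ := (cF _ _).1 hm'
            exact ⟨l, fun _ => ⟨m', hl, e'⟩⟩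
          · exact ⟨0, fun h => (hj h).elim⟩
        choose l hl using this
        refine ⟨max k ((Finset.range y).sup l), ⟨m, mF _ _ _ _ (initSeg_prefix A (le_max_left _ _)) hk, e⟩, ?_⟩
        intro j hj
        obtain ⟨a, ha, e'⟩ := hl j hj
        exact ⟨a, mF _ _ _ _ (initSeg_prefix A ((Finset.le_sup (Finset.mem_range.2 hj)).trans (le_max_right _ _))) ha, e'⟩
      · rintro ⟨k, ⟨m, hm, e⟩, h2⟩
        refine ⟨⟨m, (cF _ _).2 ⟨k, hm⟩, e⟩, fun j hj => ?_⟩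
        obtain ⟨m', hm', e'⟩ := h2 j hj
        exact ⟨m', (cF _ _).2 ⟨k, hm'⟩, e'⟩


theorem mem_ceSet {A : Set ℕ} {e x : ℕ} : x ∈ ceSet A e ↔
    ∃ k y, y ∈ Nat.Partrec.Code.eval (Denumerable.ofNat Nat.Partrec.Code e)
      (Encodable.encode (initSeg A k, x)) :=
  exists_congr fun _ => Part.dom_iff_mem

theorem ceSet_of_recursiveIn (A : Set ℕ) {f : ℕ →. ℕ} (hf : Nat.RecursiveIn {oracleOf A} f) :
    ∃ e, ceSet A e = f.Dom := by
  obtain ⟨F, hF, -, cF⟩ := use_principle A hf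
  have hF' : Nat.Partrec _ := hF
  obtain ⟨c, hc⟩ := Nat.Partrec.Code.exists_code.1 hF'
  refine ⟨Encodable.encode c, ?_⟩
  have key : ∀ k x y, y ∈ c.eval (Encodable.encode (initSeg A k, x)) ↔ y ∈ F (initSeg A k) x := by
    intro k x y
    have : c.eval (Encodable.encode (initSeg A k, x)) = F (initSeg A k) x := by
      rw [hc]
      simp only [Encodable.encodek]
      exact (Part.bind_some _ _).trans (Part.map_id' (fun _ => rfl) _)
    rw [this]
  ext x
  rw [mem_ceSet, Denumerable.ofNat_encode]
  simp only [key]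
  refine ⟨?_, ?_⟩
  · rintro ⟨k, y, hy⟩
    exact Part.dom_iff_mem.2 ⟨y, (cF _ _).2 ⟨k, hy⟩⟩
  · intro h
    obtain ⟨y, hy⟩ := Part.dom_iff_mem.1 h
    obtain ⟨k, hk⟩ := (cF _ _).1 hy
    exact ⟨k, y, hk⟩

theorem compTot {O : Set (ℕ →. ℕ)} {f g : ℕ → ℕ} (hf : Nat.RecursiveIn O fun n => Part.some (f n))
    (hg : Nat.RecursiveIn O fun n => Part.some (g n)) :
    Nat.RecursiveIn O fun n => Part.some (f (g n)) :=
  (hf.comp hg).of_eq fun _ => Part.bind_some _ _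

theorem pairTot {O : Set (ℕ →. ℕ)} {f g : ℕ → ℕ} (hf : Nat.RecursiveIn O fun n => Part.some (f n))
    (hg : Nat.RecursiveIn O fun n => Part.some (g n)) :
    Nat.RecursiveIn O fun n => Part.some (Nat.pair (f n) (g n)) :=
  (hf.pair hg).of_eq fun n => by simp [Seq.seq]

theorem recTot {O : Set (ℕ →. ℕ)} {h : ℕ → ℕ} (c : ℕ) (hh : Nat.RecursiveIn O fun n => Part.some (h n)) :
    Nat.RecursiveIn O fun n => Part.some (Nat.rec c (fun y i => h (Nat.pair 0 (Nat.pair y i))) n : ℕ) := by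
  have hz : Nat.RecursiveIn O (fun _ => Part.some c) := Nat.Primrec.recursiveIn (Nat.Primrec.const _)
  have hi : Nat.RecursiveIn O (fun n => Part.some (Nat.pair 0 n)) :=
    Nat.Primrec.recursiveIn ((Nat.Primrec.const 0).pair Nat.Primrec.id)
  refine ((Nat.RecursiveIn.prec hz hh).comp hi).of_eq fun n => ?_
  refine (Part.bind_some _ _).trans ?_
  simp only [Nat.unpair_pair]
  induction n with
  | zero => rfl
  | succ n ih => simp only [ih]; exact Part.bind_some _ _

theorem recursiveIn_initSeg (A : Set ℕ) :
    Nat.RecursiveIn {oracleOf A} (fun k => Part.some (Encodable.encode (initSeg A k))) := by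
  classical
  have hg : Primrec (fun q : ℕ => Encodable.encode
      (((Encodable.decode (α := List Bool) q.unpair.1).getD []) ++ [decide (q.unpair.2 = 1)])) := by
    refine Primrec.encode.comp (Primrec.list_append.comp ?_ ?_)
    · exact Primrec.option_getD.comp (Primrec.decode.comp (Primrec.fst.comp Primrec.unpair)) (Primrec.const [])
    · exact Primrec.list_cons.comp (Primrec.eq.comp (Primrec.snd.comp Primrec.unpair) (Primrec.const 1)).decide (Primrec.const [])
  have hg' := Nat.Primrec.recursiveIn (O := {oracleOf A}) (Primrec.nat_iff.1 hg)
  have hO : Nat.RecursiveIn {oracleOf A} (fun n => Part.some (if n ∈ A then 1 else 0)) :=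
    (Nat.RecursiveIn.oracle (oracleOf A) (Set.mem_singleton _)).of_eq fun n => by
      simp only [oracleOf]
  have hl : Nat.RecursiveIn {oracleOf A} (fun n => Part.some n.unpair.1) := .left
  have hr : Nat.RecursiveIn {oracleOf A} (fun n => Part.some n.unpair.2) := .right
  have hs := compTot hg' (pairTot (compTot hr hr) (compTot hO (compTot hl hr)))
  refine (recTot (Encodable.encode ([] : List Bool)) hs).of_eq fun k => ?_
  congr 1
  induction k with
  | zero => rfl
  | succ k ih =>
    simp only [ih]
    by_cases h : k ∈ A <;> simp [h, initSeg, List.range_succ]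

theorem recursiveIn_of_ceSet (A : Set ℕ) (e : ℕ) :
    ∃ f : ℕ →. ℕ, Nat.RecursiveIn {oracleOf A} f ∧ ceSet A e = f.Dom := by
  classical
  let c := Denumerable.ofNat Nat.Partrec.Code e
  let g : ℕ → ℕ := fun q => bif (Nat.Partrec.Code.evaln q.unpair.2.unpair.1 c
      (Nat.pair q.unpair.2.unpair.2 q.unpair.1)).isSome then 0 else 1
  have hg : Nat.Primrec g := by
    refine Primrec.nat_iff.1 (Primrec.cond (Primrec.option_isSome.comp ?_) (Primrec.const 0) (Primrec.const 1))
    have h2 : Primrec fun q : ℕ => q.unpair.2 := Primrec.snd.comp Primrec.unpair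
    refine Nat.Partrec.Code.primrec_evaln.comp (((Primrec.fst.comp (Primrec.unpair.comp h2)).pair (Primrec.const c)).pair ?_)
    exact Primrec₂.natPair.comp (Primrec.snd.comp (Primrec.unpair.comp h2)) (Primrec.fst.comp Primrec.unpair)
  have hl : Nat.RecursiveIn {oracleOf A} (fun n => Part.some n.unpair.1) := .left
  have hr : Nat.RecursiveIn {oracleOf A} (fun n => Part.some n.unpair.2) := .right
  have h1 := compTot (Nat.Primrec.recursiveIn (O := {oracleOf A}) hg)
    (pairTot hl (pairTot (compTot hl hr) (compTot (recursiveIn_initSeg A) (compTot hr hr))))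
  refine ⟨_, h1.rfind, ?_⟩
  ext x
  rw [mem_ceSet]
  refine Iff.trans ?_ Part.dom_iff_mem.symm
  simp only [mem_rfind', Part.map_eq_map, Part.map_some, Part.mem_some_iff, Nat.unpair_pair, g]
  have e2 : ∀ (P : ℕ → Bool), (∃ y, true = P y ∧ ∀ m, m < y → false = P m) ↔ ∃ y, P y = true := by
    intro P
    constructor
    · rintro ⟨y, h, -⟩
      exact ⟨y, h.symm⟩
    · intro h
      refine ⟨Nat.find h, (Nat.find_spec h).symm, fun m hm => ?_⟩
      simpa using (Nat.find_min h hm)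
  rw [e2]
  constructor
  · rintro ⟨k, y, hy⟩
    obtain ⟨s, hs⟩ := Nat.Partrec.Code.evaln_complete.1 hy
    refine ⟨Nat.pair s k, ?_⟩
    have : (Nat.Partrec.Code.evaln s c (Nat.pair (Encodable.encode (initSeg A k)) x)).isSome = true :=
      Option.isSome_iff_exists.2 ⟨y, hs⟩
    simp [this]
  · rintro ⟨m, hm⟩
    rcases h : (Nat.Partrec.Code.evaln m.unpair.1 c
      (Nat.pair (Encodable.encode (initSeg A m.unpair.2)) x)) with _ | y
    · simp [h] at hm
    · exact ⟨m.unpair.2, y, Nat.Partrec.Code.evaln_sound h⟩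

/-- The sets `W_e^A` are exactly the domains of the partial functions that are recursive in `A`, in
the sense of Mathlib's `Nat.RecursiveIn`. -/
theorem exists_eq_ceSet_iff (A S : Set ℕ) :
    (∃ e, S = ceSet A e) ↔ ∃ f : ℕ →. ℕ, Nat.RecursiveIn {oracleOf A} f ∧ S = f.Dom := by
  constructor
  · rintro ⟨e, rfl⟩
    exact recursiveIn_of_ceSet A e
  · rintro ⟨f, hf, rfl⟩
    obtain ⟨e, he⟩ := ceSet_of_recursiveIn A hf
    exact ⟨e, he.symm⟩

end OracleUse

/-! Suppose `x` is 1-generic relative to `A`, `f` is `A`-computable and differentiable, and `f' x <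
q` with `q` rational. For small rational `δ`, the point `x` lies in the class of all `t` whose
forward difference quotients over distances below `δ` are at most `q`. Failure of this condition at
`t` is witnessed by finitely many strict rational inequalities, so the class is `Π⁰₁(A)`
(`isPiClass_slopeClass`), and genericity puts `x` in its interior. Near `x` all difference quotients
over small distances are then at most `q`, hence so is `f'` (`IsOneGenericIn.eventually_deriv_le`).
The same argument for `-f` bounds `f'` from below, so `f'` is continuous at `x`.

Conversely, let `x` be a boundary point of a `Π⁰₁(A)` class `V`. The complement of `V` is the trace
on `[0,1]` of a union of rational open intervals enumerated by `A`. A dyadic interval of level `n`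
is selected when it lies in one of the first `n` intervals while its parent is not yet covered in
this sense. Selection is decidable in `A`, and selected intervals have disjoint interiors. In the
middle of each selected interval of level `n` sits a continuously differentiable bump whose height
and radius are both `2^(-4n-2)`. Let `f` be the sum of the bumps.

The bumps are so low and so far from the ends of their intervals that `f t ≤ 8 (t - x)²` at every
`x` outside the open set (`bumpSeries_le_sq`), so the derivative vanishes there. Inside the open set
the sum is locally finite (`differentiableAt_bumpSeries`). But every bump has a point of slope above
`1/2` (`not_forall_abs_deriv_le`), and selected intervals accumulate at `x`
(`exists_selected_near`), so `f'` is discontinuous at `x`. The partial sums are computable on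
rationals, with explicit tail and Lipschitz bounds, which makes `f` an `A`-computable function
(`isComputableFunIn_bumpSeries`).

The statement on `n`-genericity is the case `A = ∅^(n-1)`. The early sections supply primitive
recursive rational arithmetic and a small calculus of computability relative to `A`. -/

/-! ### Rational numbers as a primitively codable type -/

namespace RatCode

/-- The rational number `(p - m) / d`. -/
def mkQ (p m d : ℕ) : ℚ := ((p : ℚ) - m) / d

/-- The code of `(p - m) / d`, computed by arithmetic on natural numbers. -/
def mkCode (p m d : ℕ) : ℕ :=
  -- Division by zero gives `0`, whose reduced code is `0/1`. Otherwise at most one of the truncated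
  -- differences `p - m`, `m - p` is nonzero, and their sum is the absolute value of the numerator.
  if d = 0 then Nat.pair (Nat.pair 0 0) 1 else
    Nat.pair (Nat.pair ((p - m) / d.gcd ((p - m) + (m - p))) ((m - p) / d.gcd ((p - m) + (m - p))))
      (d / d.gcd ((p - m) + (m - p)))

theorem ratCode_mkQ (p m d : ℕ) : ratCode (mkQ p m d) = mkCode p m d := by
  have h : mkQ p m d = mkRat ((p : ℤ) - m) d := by
    rw [Rat.mkRat_eq_div]; simp [mkQ]
  unfold ratCode mkCode
  by_cases hd : d = 0
  · subst hd
    have h0 : mkQ p m 0 = 0 := by simp [mkQ]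
    simp [h0]
  · have e : ((p : ℤ) - m).natAbs = (p - m) + (m - p) := by omega
    rw [h, Rat.num_mkRat, Rat.den_mkRat, if_neg hd, if_neg hd, if_neg hd, e]
    rcases le_total m p with hle | hle
    · obtain ⟨k, rfl⟩ := Nat.exists_eq_add_of_le hle
      have h1 : ((m + k : ℕ) : ℤ) - m = (k : ℕ) := by push_cast; ring
      have h2 : m - (m + k) = 0 := by omega
      have h3 : m + k - m = k := by omega
      rw [h1, h2, h3, Nat.zero_div]
      have h4 : (-((k / d.gcd (k + 0) : ℕ) : ℤ)).toNat = 0 := Int.toNat_neg_natCast _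
      norm_cast
      rw [h4]
    · obtain ⟨k, rfl⟩ := Nat.exists_eq_add_of_le hle
      have h1 : (p : ℤ) - (p + k : ℕ) = -(k : ℕ) := by push_cast; ring
      have h2 : p - (p + k) = 0 := by omega
      have h3 : p + k - p = k := by omega
      rw [h1, h2, h3, Nat.zero_div, zero_add, Int.neg_ediv_of_dvd (by exact_mod_cast Nat.gcd_dvd_right _ _), neg_neg]
      have h4 : (-((k / d.gcd k : ℕ) : ℤ)).toNat = 0 := Int.toNat_neg_natCast _
      norm_cast
      rw [h4]

theorem mkQ_num_den (q : ℚ) : mkQ q.num.toNat (-q.num).toNat q.den = q := by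
  have h : ((q.num.toNat : ℚ)) - ((-q.num).toNat : ℚ) = q.num := by
    have : ((q.num.toNat : ℤ)) - ((-q.num).toNat : ℤ) = q.num := by omega
    exact_mod_cast this
  rw [mkQ, h, Rat.num_div_den]

/-- Bounded search for the largest common divisor up to `a + b`; when both numbers are `0` the bound
forces the correct value `0`. -/
theorem primrec_gcd : Primrec₂ Nat.gcd := by
  have h : Primrec fun p : ℕ × ℕ => (p.1 + p.2).findGreatest fun d => p.1 % d = 0 ∧ p.2 % d = 0 := by
    refine Primrec.nat_findGreatest (Primrec.nat_add.comp .fst .snd) ?_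
    refine PrimrecPred.and ?_ ?_
    · exact Primrec.eq.comp (Primrec.nat_mod.comp (Primrec.fst.comp .fst) .snd) (.const 0)
    · exact Primrec.eq.comp (Primrec.nat_mod.comp (Primrec.snd.comp .fst) .snd) (.const 0)
  refine h.of_eq fun ⟨a, b⟩ => ?_
  dsimp only
  rw [Nat.findGreatest_eq_iff]
  refine ⟨?_, fun _ => ⟨Nat.mod_eq_zero_of_dvd (Nat.gcd_dvd_left a b),
    Nat.mod_eq_zero_of_dvd (Nat.gcd_dvd_right a b)⟩, ?_⟩
  · rcases Nat.eq_zero_or_pos a with rfl | ha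
    · simp
    · exact (Nat.gcd_le_left b ha).trans (Nat.le_add_right _ _)
  · rintro n hn hle ⟨h1, h2⟩
    have hdvd := Nat.dvd_gcd (Nat.dvd_of_mod_eq_zero h1) (Nat.dvd_of_mod_eq_zero h2)
    have : 0 < a.gcd b := Nat.pos_of_ne_zero fun h0 => by
      have := Nat.gcd_eq_zero_iff.1 h0
      omega
    exact absurd (Nat.le_of_dvd this hdvd) (by omega)

theorem primrec_mkCode : Primrec fun x : (ℕ × ℕ) × ℕ => mkCode x.1.1 x.1.2 x.2 := by
  have p : Primrec fun x : (ℕ × ℕ) × ℕ => x.1.1 := Primrec.fst.comp .fst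
  have m : Primrec fun x : (ℕ × ℕ) × ℕ => x.1.2 := Primrec.snd.comp .fst
  have d : Primrec fun x : (ℕ × ℕ) × ℕ => x.2 := .snd
  have a := Primrec.nat_sub.comp p m
  have b := Primrec.nat_sub.comp m p
  have g := primrec_gcd.comp d (Primrec.nat_add.comp a b)
  exact Primrec.ite (Primrec.eq.comp d (.const 0)) (.const _)
    (Primrec₂.natPair.comp (Primrec₂.natPair.comp (Primrec.nat_div.comp a g) (Primrec.nat_div.comp b g))
      (Primrec.nat_div.comp d g))

theorem primrec_unpair₃ : Primrec fun n : ℕ => ((n.unpair.1.unpair.1, n.unpair.1.unpair.2), n.unpair.2) := by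
  have h1 : Primrec fun n : ℕ => n.unpair.1 := Primrec.fst.comp Primrec.unpair
  exact ((Primrec.fst.comp (Primrec.unpair.comp h1)).pair (Primrec.snd.comp (Primrec.unpair.comp h1))).pair
    (Primrec.snd.comp Primrec.unpair)

/-- Rational numbers, coded by `ratCode`. -/
instance : Primcodable ℚ where
  encode := ratCode
  decode n :=
    if ratCode (mkQ n.unpair.1.unpair.1 n.unpair.1.unpair.2 n.unpair.2) = n then
      some (mkQ n.unpair.1.unpair.1 n.unpair.1.unpair.2 n.unpair.2) else none
  encodek q := by
    have h : mkQ (ratCode q).unpair.1.unpair.1 (ratCode q).unpair.1.unpair.2 (ratCode q).unpair.2 = q := by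
      simpa [ratCode] using mkQ_num_den q
    simp only [h, if_true]
  prim := by
    -- An option is coded with a shift by one, so `encode (decode n)` is `n + 1` when `n` is a
    -- reduced code and `0` otherwise.
    have h : Primrec fun n : ℕ => if mkCode n.unpair.1.unpair.1 n.unpair.1.unpair.2 n.unpair.2 = n
        then n + 1 else 0 :=
      Primrec.ite (Primrec.eq.comp (primrec_mkCode.comp primrec_unpair₃) .id) .succ (.const 0)
    refine (Primrec.nat_iff.1 h).of_eq fun n => ?_
    simp only [← ratCode_mkQ]
    by_cases h : ratCode (mkQ n.unpair.1.unpair.1 n.unpair.1.unpair.2 n.unpair.2) = n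
    · rw [if_pos h, if_pos h]
      change n + 1 = ratCode _ + 1
      rw [h]
    · rw [if_neg h, if_neg h]
      rfl

theorem encode_rat (q : ℚ) : @Encodable.encode ℚ Primcodable.toEncodable q = ratCode q := rfl

theorem encode_rat_pair (a b : ℚ) :
    @Encodable.encode (ℚ × ℚ) Primcodable.toEncodable (a, b) = ratPairCode a b := rfl

theorem primrec_mkQ : Primrec fun x : (ℕ × ℕ) × ℕ => mkQ x.1.1 x.1.2 x.2 := by
  rw [← Primrec.encode_iff]
  exact primrec_mkCode.of_eq fun x => (ratCode_mkQ _ _ _).symm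

theorem primrec_code : Primrec fun q : ℚ => ((q.num.toNat, (-q.num).toNat), q.den) :=
  (primrec_unpair₃.comp (Primrec.encode (α := ℚ))).of_eq fun q => by simp [encode_rat, ratCode]

theorem primrec_pos : Primrec fun q : ℚ => q.num.toNat := Primrec.fst.comp (Primrec.fst.comp primrec_code)
theorem primrec_neg : Primrec fun q : ℚ => (-q.num).toNat := Primrec.snd.comp (Primrec.fst.comp primrec_code)
theorem primrec_den : Primrec fun q : ℚ => q.den := Primrec.snd.comp primrec_code

/-- Rational arithmetic is carried out on fractions with numerator split into positive and negative
part; results need not be reduced, since `mkQ` accepts any such triple. -/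
theorem rat_eq (q : ℚ) : q = ((q.num.toNat : ℚ) - (-q.num).toNat) / q.den := (mkQ_num_den q).symm

theorem primrec_rat_add : Primrec₂ fun a b : ℚ => a + b := by
  have p1 := primrec_pos.comp (Primrec.fst (α := ℚ) (β := ℚ))
  have p2 := primrec_pos.comp (Primrec.snd (α := ℚ) (β := ℚ))
  have m1 := primrec_neg.comp (Primrec.fst (α := ℚ) (β := ℚ))
  have m2 := primrec_neg.comp (Primrec.snd (α := ℚ) (β := ℚ))
  have d1 := primrec_den.comp (Primrec.fst (α := ℚ) (β := ℚ))
  have d2 := primrec_den.comp (Primrec.snd (α := ℚ) (β := ℚ))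
  refine (primrec_mkQ.comp ((Primrec.pair (Primrec.nat_add.comp (Primrec.nat_mul.comp p1 d2) (Primrec.nat_mul.comp p2 d1))
    (Primrec.nat_add.comp (Primrec.nat_mul.comp m1 d2) (Primrec.nat_mul.comp m2 d1))).pair
    (Primrec.nat_mul.comp d1 d2))).of_eq fun ⟨a, b⟩ => ?_
  have ha : (a.den : ℚ) ≠ 0 := by exact_mod_cast a.den_nz
  have hb : (b.den : ℚ) ≠ 0 := by exact_mod_cast b.den_nz
  conv_rhs => rw [rat_eq a, rat_eq b]
  simp only [mkQ]
  push_cast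
  field_simp
  ring

theorem primrec_rat_mul : Primrec₂ fun a b : ℚ => a * b := by
  have p1 := primrec_pos.comp (Primrec.fst (α := ℚ) (β := ℚ))
  have p2 := primrec_pos.comp (Primrec.snd (α := ℚ) (β := ℚ))
  have m1 := primrec_neg.comp (Primrec.fst (α := ℚ) (β := ℚ))
  have m2 := primrec_neg.comp (Primrec.snd (α := ℚ) (β := ℚ))
  have d1 := primrec_den.comp (Primrec.fst (α := ℚ) (β := ℚ))
  have d2 := primrec_den.comp (Primrec.snd (α := ℚ) (β := ℚ))
  refine (primrec_mkQ.comp ((Primrec.pair (Primrec.nat_add.comp (Primrec.nat_mul.comp p1 p2) (Primrec.nat_mul.comp m1 m2))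
    (Primrec.nat_add.comp (Primrec.nat_mul.comp p1 m2) (Primrec.nat_mul.comp m1 p2))).pair
    (Primrec.nat_mul.comp d1 d2))).of_eq fun ⟨a, b⟩ => ?_
  have ha : (a.den : ℚ) ≠ 0 := by exact_mod_cast a.den_nz
  have hb : (b.den : ℚ) ≠ 0 := by exact_mod_cast b.den_nz
  conv_rhs => rw [rat_eq a, rat_eq b]
  simp only [mkQ]
  push_cast
  field_simp
  ring

theorem primrec_rat_neg : Primrec fun a : ℚ => -a :=
  (primrec_rat_mul.comp (.const (-1)) .id).of_eq fun a => by simp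

theorem primrec_rat_sub : Primrec₂ fun a b : ℚ => a - b :=
  (primrec_rat_add.comp .fst (primrec_rat_neg.comp .snd)).of_eq fun a => by simp [sub_eq_add_neg]

theorem primrec_rat_natCast : Primrec fun n : ℕ => (n : ℚ) :=
  (primrec_mkQ.comp ((Primrec.id.pair (.const 0)).pair (.const 1))).of_eq fun n => by simp [mkQ]

theorem primrec_rat_invNat : Primrec fun n : ℕ => (n : ℚ)⁻¹ :=
  (primrec_mkQ.comp ((Primrec.pair (.const 1) (.const 0)).pair .id)).of_eq fun n => by simp [mkQ]

theorem primrec_rat_lt : PrimrecRel fun a b : ℚ => a < b := by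
  have p1 := primrec_pos.comp (Primrec.fst (α := ℚ) (β := ℚ))
  have p2 := primrec_pos.comp (Primrec.snd (α := ℚ) (β := ℚ))
  have m1 := primrec_neg.comp (Primrec.fst (α := ℚ) (β := ℚ))
  have m2 := primrec_neg.comp (Primrec.snd (α := ℚ) (β := ℚ))
  have d1 := primrec_den.comp (Primrec.fst (α := ℚ) (β := ℚ))
  have d2 := primrec_den.comp (Primrec.snd (α := ℚ) (β := ℚ))
  refine PrimrecPred.of_eq (Primrec.nat_lt.comp
    (Primrec.nat_add.comp (Primrec.nat_mul.comp p1 d2) (Primrec.nat_mul.comp m2 d1))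
    (Primrec.nat_add.comp (Primrec.nat_mul.comp p2 d1) (Primrec.nat_mul.comp m1 d2))) fun ⟨a, b⟩ => ?_
  have ha : (0 : ℚ) < a.den := by exact_mod_cast a.den_pos
  have hb : (0 : ℚ) < b.den := by exact_mod_cast b.den_pos
  dsimp only
  conv_rhs => rw [rat_eq a, rat_eq b]
  rw [div_lt_div_iff₀ ha hb, ← Nat.cast_lt (α := ℚ)]
  push_cast
  constructor <;> intro h <;> linarith

theorem primrec_rat_le : PrimrecRel fun a b : ℚ => a ≤ b :=
  (PrimrecPred.not (primrec_rat_lt.comp Primrec.snd Primrec.fst)).of_eq fun a => by simp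

theorem primrec_rat_max : Primrec₂ fun a b : ℚ => max a b :=
  (Primrec.ite (primrec_rat_le.comp Primrec.fst Primrec.snd) .snd .fst).of_eq fun a => by
    simp [max_def]

theorem primrec_two_pow : Primrec fun n : ℕ => 2 ^ n :=
  (Primrec₂.unpaired'.1 Nat.Primrec.pow).comp (.const 2) .id

end RatCode

/-! ### Total functions, decidable and enumerable predicates relative to an oracle -/

section Relative

variable {α β γ δ : Type*} [Primcodable α] [Primcodable β] [Primcodable γ] [Primcodable δ]

/-- The total function `f` between primitively codable types is computable in `A`. -/
def RelComp (A : Set ℕ) (f : α → β) : Prop :=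
  ∃ g : ℕ → ℕ, Nat.RecursiveIn {oracleOf A} (fun n => Part.some (g n)) ∧
    ∀ a, g (Encodable.encode a) = Encodable.encode (f a)

/-- The predicate `p` is decidable with the help of `A`. -/
def RelDec (A : Set ℕ) (p : α → Prop) : Prop :=
  ∃ b : α → Bool, RelComp A b ∧ ∀ a, b a = true ↔ p a

/-- The predicate `p` is computably enumerable in `A`. -/
def RelEnum (A : Set ℕ) (p : α → Prop) : Prop :=
  ∃ R : α × ℕ → Prop, RelDec A R ∧ ∀ a, p a ↔ ∃ m, R (a, m)

variable {A : Set ℕ}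

namespace RelComp

theorem of_primrec {f : α → β} (hf : Primrec f) : RelComp A f := by
  -- The predecessor removes the shift by one in the code of `some`; the value at numbers that code
  -- nothing is irrelevant.
  refine ⟨fun n => (Encodable.encode ((Encodable.decode n : Option α).map f)).pred, ?_, fun a => by simp⟩
  exact Nat.Primrec.recursiveIn (Primrec.nat_iff.1 (Primrec.pred.comp (Primrec.nat_iff.2 hf)))

theorem comp {f : β → γ} {g : α → β} (hf : RelComp A f) (hg : RelComp A g) :
    RelComp A fun a => f (g a) := by
  obtain ⟨F, hF, eF⟩ := hf
  obtain ⟨G, hG, eG⟩ := hg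
  exact ⟨fun n => F (G n), OracleUse.compTot hF hG, fun a => by simp only [eG, eF]⟩

theorem pair {f : α → β} {g : α → γ} (hf : RelComp A f) (hg : RelComp A g) :
    RelComp A fun a => (f a, g a) := by
  obtain ⟨F, hF, eF⟩ := hf
  obtain ⟨G, hG, eG⟩ := hg
  exact ⟨fun n => Nat.pair (F n) (G n), OracleUse.pairTot hF hG, fun a => by simp only [eG, eF]; rfl⟩

theorem comp₂ {f : β → γ → δ} {g : α → β} {h : α → γ} (hf : Primrec₂ f) (hg : RelComp A g)
    (hh : RelComp A h) : RelComp A fun a => f (g a) (h a) :=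
  (of_primrec hf).comp (hg.pair hh)

theorem fst : RelComp A (Prod.fst : α × β → α) := of_primrec .fst
theorem snd : RelComp A (Prod.snd : α × β → β) := of_primrec .snd
theorem const (b : β) : RelComp A (fun _ : α => b) := of_primrec (.const b)
theorem id : RelComp A (fun a : α => a) := of_primrec .id

theorem of_eq {f g : α → β} (hf : RelComp A f) (h : ∀ a, f a = g a) : RelComp A g :=
  funext h ▸ hf

theorem nat_rec {f : α → ℕ} {g : α → β} {h : (α × ℕ) × β → β} (hf : RelComp A f)
    (hg : RelComp A g) (hh : RelComp A h) :
    RelComp A fun a => (Nat.rec (g a) (fun n b => h ((a, n), b)) (f a) : β) := by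
  obtain ⟨F, hF, eF⟩ := hf
  obtain ⟨G, hG, eG⟩ := hg
  obtain ⟨H, hH, eH⟩ := hh
  have hl : Nat.RecursiveIn {oracleOf A} (fun n => Part.some n.unpair.1) := .left
  have hr : Nat.RecursiveIn {oracleOf A} (fun n => Part.some n.unpair.2) := .right
  have hi : Nat.RecursiveIn {oracleOf A} (fun n => Part.some n) :=
    Nat.Primrec.recursiveIn Nat.Primrec.id
  have hs := OracleUse.compTot hH (OracleUse.pairTot
    (OracleUse.pairTot hl (OracleUse.compTot hl hr)) (OracleUse.compTot hr hr))
  have hp := (Nat.RecursiveIn.prec hG hs).comp (OracleUse.pairTot hi hF)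
  refine ⟨fun a => Nat.rec (G a) (fun y i => H (Nat.pair (Nat.pair a y) i)) (F a), ?_, fun a => ?_⟩
  · refine hp.of_eq fun n => ?_
    refine (Part.bind_some _ _).trans ?_
    simp only [Nat.unpair_pair]
    induction F n with
    | zero => rfl
    | succ n ih => simp only [ih]; exact Part.bind_some _ _
  · simp only [eF, Encodable.encode_nat]
    induction f a with
    | zero => exact eG a
    | succ n ih =>
      simp only [ih]
      exact eH ((a, n), _)

theorem sum {f : α → ℕ} {h : α × ℕ → ℚ} (hf : RelComp A f) (hh : RelComp A h) :
    RelComp A fun a => ∑ i ∈ Finset.range (f a), h (a, i) := by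
  refine (nat_rec (h := fun x : (α × ℕ) × ℚ => x.2 + h x.1) hf (const (0 : ℚ))
    (comp₂ RatCode.primrec_rat_add snd (hh.comp fst))).of_eq fun a => ?_
  induction f a with
  | zero => rfl
  | succ n ih => simp only [ih, Finset.sum_range_succ]

theorem ite {p : α → Prop} [DecidablePred p] {f g : α → β} (hp : RelDec A p) (hf : RelComp A f)
    (hg : RelComp A g) : RelComp A fun a => if p a then f a else g a := by
  obtain ⟨b, hb, eb⟩ := hp
  have hc : Primrec fun x : Bool × β × β => bif x.1 then x.2.1 else x.2.2 :=
    Primrec.cond .fst (Primrec.fst.comp .snd) (Primrec.snd.comp .snd)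
  refine ((of_primrec hc).comp (hb.pair (hf.pair hg))).of_eq fun a => ?_
  by_cases h : p a
  · simp [h, (eb a).2 h]
  · have : b a = false := by simpa [h] using eb a
    simp [h, this]

theorem computableIn {f : ℕ → ℕ} (hf : RelComp A f) : ComputableIn {oracleOf A} f := by
  obtain ⟨g, hg, e⟩ := hf
  obtain rfl : g = f := funext e
  exact RecursiveIn.iff_nat.2 hg

theorem of_computableIn {f : ℕ → ℕ} (hf : ComputableIn {oracleOf A} f) : RelComp A f :=
  ⟨f, RecursiveIn.iff_nat.1 hf, fun _ => rfl⟩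

end RelComp

namespace RelDec

theorem of_primrecPred {p : α → Prop} (hp : PrimrecPred p) : RelDec A p := by
  obtain ⟨_, h⟩ := hp
  exact ⟨_, .of_primrec h, fun a => by simp⟩

theorem of_eq {p q : α → Prop} (hp : RelDec A p) (h : ∀ a, p a ↔ q a) : RelDec A q :=
  (funext fun a => propext (h a) : p = q) ▸ hp

theorem comp {p : β → Prop} {f : α → β} (hp : RelDec A p) (hf : RelComp A f) :
    RelDec A fun a => p (f a) := by
  obtain ⟨b, hb, e⟩ := hp
  exact ⟨_, hb.comp hf, fun a => e _⟩

theorem comp₂ {R : β → γ → Prop} {f : α → β} {g : α → γ} (hR : PrimrecRel R) (hf : RelComp A f)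
    (hg : RelComp A g) : RelDec A fun a => R (f a) (g a) :=
  (of_primrecPred hR).comp (hf.pair hg)

theorem and {p q : α → Prop} (hp : RelDec A p) (hq : RelDec A q) :
    RelDec A fun a => p a ∧ q a := by
  obtain ⟨b, hb, eb⟩ := hp
  obtain ⟨c, hc, ec⟩ := hq
  exact ⟨_, .comp₂ Primrec.and hb hc, fun a => by simp [eb, ec]⟩

theorem not {p : α → Prop} (hp : RelDec A p) : RelDec A fun a => ¬ p a := by
  obtain ⟨b, hb, eb⟩ := hp
  exact ⟨_, (RelComp.of_primrec Primrec.not).comp hb, fun a => by simp [← eb]⟩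

theorem exists_lt {f : α → ℕ} {p : α × ℕ → Prop} (hf : RelComp A f) (hp : RelDec A p) :
    RelDec A fun a => ∃ i < f a, p (a, i) := by
  obtain ⟨b, hb, eb⟩ := hp
  refine ⟨_, RelComp.nat_rec (h := fun x : (α × ℕ) × Bool => x.2 || b x.1) hf (.const false)
    (.comp₂ Primrec.or .snd (hb.comp .fst)), fun a => ?_⟩
  dsimp only
  generalize f a = n
  induction n with
  | zero => simp
  | succ n ih =>
    simp only [Bool.or_eq_true, ih, eb, Nat.lt_succ_iff_lt_or_eq]
    constructor
    · rintro (⟨i, h, h'⟩ | h)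
      exacts [⟨i, .inl h, h'⟩, ⟨n, .inr rfl, h⟩]
    · rintro ⟨i, h | rfl, h'⟩
      exacts [.inl ⟨i, h, h'⟩, .inr h']

theorem rat_lt {f g : α → ℚ} (hf : RelComp A f) (hg : RelComp A g) : RelDec A fun a => f a < g a :=
  comp₂ RatCode.primrec_rat_lt hf hg

theorem rat_le {f g : α → ℚ} (hf : RelComp A f) (hg : RelComp A g) : RelDec A fun a => f a ≤ g a :=
  comp₂ RatCode.primrec_rat_le hf hg

end RelDec

namespace RelEnum

theorem of_relDec {p : α → Prop} (hp : RelDec A p) : RelEnum A p :=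
  ⟨_, hp.comp .fst, fun _ => by simp⟩

theorem of_eq {p q : α → Prop} (hp : RelEnum A p) (h : ∀ a, p a ↔ q a) : RelEnum A q :=
  (funext fun a => propext (h a) : p = q) ▸ hp

theorem comp {p : β → Prop} {f : α → β} (hp : RelEnum A p) (hf : RelComp A f) :
    RelEnum A fun a => p (f a) := by
  obtain ⟨R, hR, e⟩ := hp
  exact ⟨fun x => R (f x.1, x.2), hR.comp ((hf.comp .fst).pair .snd), fun a => e _⟩

theorem and {p q : α → Prop} (hp : RelEnum A p) (hq : RelEnum A q) :
    RelEnum A fun a => p a ∧ q a := by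
  obtain ⟨R, hR, eR⟩ := hp
  obtain ⟨S, hS, eS⟩ := hq
  have h2 : RelComp A fun x : α × ℕ => x.2.unpair := .of_primrec (Primrec.unpair.comp .snd)
  refine ⟨fun x => R (x.1, x.2.unpair.1) ∧ S (x.1, x.2.unpair.2),
    (hR.comp (RelComp.fst.pair (RelComp.fst.comp h2))).and
      (hS.comp (RelComp.fst.pair (RelComp.snd.comp h2))), fun a => ?_⟩
  simp only [eR, eS]
  constructor
  · rintro ⟨⟨m, hm⟩, n, hn⟩
    exact ⟨Nat.pair m n, by simpa using ⟨hm, hn⟩⟩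
  · rintro ⟨m, h1, h2⟩
    exact ⟨⟨_, h1⟩, _, h2⟩

/-- One search variable codes both the witness `b` and its stage. A number that decodes to nothing
stands for the default element, which is a genuine candidate, so nothing false is enumerated. -/
theorem exists_of [Inhabited β] {p : α × β → Prop} (hp : RelEnum A p) :
    RelEnum A fun a => ∃ b, p (a, b) := by
  obtain ⟨R, hR, eR⟩ := hp
  have h2 : Primrec fun x : α × ℕ => x.2.unpair := Primrec.unpair.comp .snd
  have hd : Primrec fun x : α × ℕ => ((Encodable.decode x.2.unpair.1 : Option β).getD default) :=
    Primrec.option_getD.comp (Primrec.decode.comp (Primrec.fst.comp h2)) (.const _)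
  refine ⟨fun x => R ((x.1, (Encodable.decode x.2.unpair.1 : Option β).getD default), x.2.unpair.2),
    hR.comp ((RelComp.fst.pair (.of_primrec hd)).pair (.of_primrec (Primrec.snd.comp h2))), fun a => ?_⟩
  constructor
  · rintro ⟨b, hb⟩
    obtain ⟨m, hm⟩ := (eR _).1 hb
    exact ⟨Nat.pair (Encodable.encode b) m, by simpa using hm⟩
  · rintro ⟨m, hm⟩
    exact ⟨_, (eR _).2 ⟨_, hm⟩⟩

/-- Halting within `s` steps on the oracle segment of length `k` is decidable in `A`, uniformly in
the program; the search runs over the pairs `(s, k)`. -/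
theorem mem_ceSet (A : Set ℕ) : RelEnum A fun x : ℕ × ℕ => x.1 ∈ ceSet A x.2 := by
  let b : (ℕ × ℕ) × ℕ → Bool := fun x => (Nat.Partrec.Code.evaln x.2.unpair.1
    (Denumerable.ofNat Nat.Partrec.Code x.1.2)
      (Nat.pair (Encodable.encode (initSeg A x.2.unpair.2)) x.1.1)).isSome
  have hb : RelComp A b := by
    have h2 : Primrec fun x : (ℕ × ℕ) × ℕ => x.2.unpair := Primrec.unpair.comp .snd
    have h0 : Primrec fun x : ((ℕ × ℕ) × ℕ) × ℕ => (Nat.Partrec.Code.evaln x.1.2.unpair.1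
        (Denumerable.ofNat Nat.Partrec.Code x.1.1.2) (Nat.pair x.2 x.1.1.1)).isSome := by
      refine Primrec.option_isSome.comp (Nat.Partrec.Code.primrec_evaln.comp
        (((Primrec.fst.comp (h2.comp .fst)).pair ?_).pair ?_))
      · exact (Primrec.ofNat Nat.Partrec.Code).comp (Primrec.snd.comp (Primrec.fst.comp .fst))
      · exact Primrec₂.natPair.comp .snd (Primrec.fst.comp (Primrec.fst.comp .fst))
    have hi : RelComp A fun k => Encodable.encode (initSeg A k) :=
      ⟨_, OracleUse.recursiveIn_initSeg A, fun _ => rfl⟩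
    exact (RelComp.of_primrec h0).comp (RelComp.id.pair
      (hi.comp (.of_primrec (Primrec.snd.comp h2))))
  refine ⟨fun x => b x = true, ⟨b, hb, fun _ => Iff.rfl⟩, fun ⟨x, e⟩ => ?_⟩
  refine OracleUse.mem_ceSet.trans ?_
  constructor
  · rintro ⟨k, y, hy⟩
    obtain ⟨s, hs⟩ := Nat.Partrec.Code.evaln_complete.1 hy
    exact ⟨Nat.pair s k, Option.isSome_iff_exists.2 ⟨y, by simpa using hs⟩⟩
  · rintro ⟨m, hm⟩
    obtain ⟨y, hy⟩ := Option.isSome_iff_exists.1 hm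
    exact ⟨_, y, Nat.Partrec.Code.evaln_sound hy⟩

/-- A predicate that is enumerable in `A` is the domain of a function recursive in `A`. -/
theorem exists_recursiveIn {p : ℕ → Prop} (hp : RelEnum A p) :
    ∃ f : ℕ →. ℕ, Nat.RecursiveIn {oracleOf A} f ∧ ∀ x, p x ↔ (f x).Dom := by
  obtain ⟨R, ⟨b, hb, eb⟩, eR⟩ := hp
  have hc : RelComp A fun x => bif b x then 0 else 1 :=
    (RelComp.of_primrec (Primrec.cond .id (.const 0) (.const 1))).comp hb
  obtain ⟨g, hg, eg⟩ := hc
  refine ⟨_, hg.rfind, fun x => ?_⟩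
  rw [eR, Part.dom_iff_mem]
  have e : ∀ m, g (Nat.pair x m) = bif b (x, m) then 0 else 1 := fun m => eg (x, m)
  have h0 : ∀ m, g (Nat.pair x m) = 0 ↔ R (x, m) := fun m => by
    rw [e, ← eb]
    cases b (x, m) <;> simp
  refine Iff.trans ?_ (exists_congr fun _ => OracleUse.mem_rfind'.symm)
  simp only [Part.map_eq_map, Part.map_some, Part.mem_some_iff, eq_comm (a := true),
    eq_comm (a := false), decide_eq_true_eq, decide_eq_false_iff_not, h0]
  constructor
  · classical
    intro h
    exact ⟨Nat.find h, Nat.find_spec h, fun m hm => Nat.find_min h hm⟩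
  · rintro ⟨m, hm, -⟩
    exact ⟨m, hm⟩

/-- The s-m-n theorem with an oracle. The use principle replaces the oracle by a finite string,
leaving an ordinary program `c` with input `(i, σ, x)`; currying in `i` yields the index. -/
theorem exists_index_nat {p : ℕ × ℕ → Prop} (hp : RelEnum A p) :
    ∃ s : ℕ → ℕ, ComputableIn {oracleOf A} s ∧ ∀ i x, x ∈ ceSet A (s i) ↔ p (i, x) := by
  obtain ⟨f, hf, ef⟩ := (hp.comp (f := Nat.unpair) (.of_primrec Primrec.unpair)).exists_recursiveIn
  obtain ⟨F, hF, -, cF⟩ := OracleUse.use_principle A hf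
  have hG : Partrec fun y : ℕ × List Bool × ℕ => F y.2.1 (Nat.pair y.1 y.2.2) :=
    hF.comp (Computable.fst.comp .snd)
      (Primrec₂.natPair.to_comp.comp .fst (Computable.snd.comp .snd))
  obtain ⟨c, hc⟩ := Nat.Partrec.Code.exists_code.1 hG
  refine ⟨fun i => Encodable.encode (c.curry i), RelComp.computableIn (.of_primrec
    (Primrec.encode.comp (Nat.Partrec.Code.primrec₂_curry.comp (.const c) .id))), fun i x => ?_⟩
  have key : ∀ k, (c.curry i).eval (Encodable.encode (initSeg A k, x)) =
      F (initSeg A k) (Nat.pair i x) := by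
    intro k
    rw [Nat.Partrec.Code.eval_curry, hc]
    beta_reduce
    have : (Encodable.decode (Nat.pair i (Encodable.encode (initSeg A k, x))) :
        Option (ℕ × List Bool × ℕ)) = some (i, initSeg A k, x) :=
      Encodable.encodek (i, initSeg A k, x)
    simp only [this]
    exact (Part.bind_some _ _).trans (Part.map_id' (fun _ => rfl) _)
  have h1 := ef (Nat.pair i x)
  rw [Nat.unpair_pair] at h1
  rw [h1, OracleUse.mem_ceSet, Denumerable.ofNat_encode, Part.dom_iff_mem]
  simp only [key, cF]
  exact exists_comm

/-- The parametrization theorem for sets computably enumerable in `A`. -/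
theorem exists_index [Inhabited α] [Inhabited β] {p : α × β → Prop} (hp : RelEnum A p) :
    ∃ s : ℕ → ℕ, ComputableIn {oracleOf A} s ∧
      ∀ (a : α) (b : β), Encodable.encode b ∈ ceSet A (s (Encodable.encode a)) ↔ p (a, b) := by
  -- The predicate is transferred to codes by quantifying over the objects coded; injectivity of
  -- coding recovers them.
  have h : RelEnum A fun x : (ℕ × ℕ) × (α × β) =>
      (Encodable.encode x.2.1 = x.1.1 ∧ Encodable.encode x.2.2 = x.1.2) ∧ p x.2 := by
    refine RelEnum.and (of_relDec (RelDec.and ?_ ?_)) (hp.comp .snd)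
    · exact .comp₂ Primrec.eq (.of_primrec (Primrec.encode.comp (Primrec.fst.comp .snd)))
        (RelComp.fst.comp .fst)
    · exact .comp₂ Primrec.eq (.of_primrec (Primrec.encode.comp (Primrec.snd.comp .snd)))
        (RelComp.snd.comp .fst)
  obtain ⟨s, hs, es⟩ := h.exists_of.exists_index_nat
  refine ⟨s, hs, fun a b => (es _ _).trans ⟨?_, fun hab => ⟨(a, b), ⟨rfl, rfl⟩, hab⟩⟩⟩
  rintro ⟨⟨a', b'⟩, ⟨h1, h2⟩, h3⟩
  obtain rfl : a' = a := Encodable.encode_injective h1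
  obtain rfl : b' = b := Encodable.encode_injective h2
  exact h3

end RelEnum

end Relative

/-! ### Derivatives are continuous at generic points -/

theorem HasDerivOnUnit.continuous {f f' : unitInterval → ℝ} (h : HasDerivOnUnit f f') :
    Continuous f := by
  have h1 : ContinuousOn (Set.IccExtend (zero_le_one' ℝ) f) (Set.Icc 0 1) := fun t ht =>
    (h ⟨t, ht⟩).continuousWithinAt
  refine (continuousOn_iff_continuous_domRestrict.1 h1).congr fun t => ?_
  simp

theorem HasDerivOnUnit.neg {f f' : unitInterval → ℝ} (h : HasDerivOnUnit f f') :
    HasDerivOnUnit (fun t => -f t) fun t => -f' t := fun t => (h t).neg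

theorem IsComputableFunIn.neg {A : Set ℕ} {f : unitInterval → ℝ} (h : IsComputableFunIn A f) :
    IsComputableFunIn A fun t => -f t := by
  obtain ⟨α, hα, e⟩ := h
  have hs : Primrec fun n : ℕ => (((@Encodable.decode (ℚ × ℚ) Primcodable.toEncodable n).map
      fun u => ratPairCode (-u.2) (-u.1)).getD 0) := by
    refine Primrec.option_getD.comp (Primrec.option_map Primrec.decode ?_) (.const 0)
    exact Primrec.encode.comp ((RatCode.primrec_rat_neg.comp (Primrec.snd.comp .snd)).pair
      (RatCode.primrec_rat_neg.comp (Primrec.fst.comp .snd)))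
  refine ⟨_, ((RelComp.of_computableIn hα).comp (.of_primrec hs)).computableIn, fun q r => ?_⟩
  rw [← RatCode.encode_rat_pair, @Encodable.encodek (ℚ × ℚ) Primcodable.toEncodable, Option.map_some, Option.getD_some, ← e]
  ext t
  simp only [Set.mem_preimage, Set.mem_Ioo, Rat.cast_neg]
  constructor <;> rintro ⟨h1, h2⟩ <;> constructor <;> linarith

theorem exists_rat_mem_of_isOpen {O : Set unitInterval} (hO : IsOpen O) (hne : O.Nonempty) :
    ∃ s : unitInterval, s ∈ O ∧ ∃ r : ℚ, (r : ℝ) = s := by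
  obtain ⟨p, hp⟩ := hne
  obtain ⟨ε, hε, hb⟩ := Metric.isOpen_iff.1 hO p hp
  have h : max 0 ((p : ℝ) - ε) < min 1 ((p : ℝ) + ε) := by
    have := p.2.1
    have := p.2.2
    simp only [max_lt_iff, lt_min_iff]
    refine ⟨⟨?_, ?_⟩, ?_, ?_⟩ <;> linarith
  obtain ⟨r, h1, h2⟩ := exists_rat_btwn h
  simp only [max_lt_iff, lt_min_iff] at h1 h2
  refine ⟨⟨r, h1.1.le, h2.1.le⟩, hb ?_, r, rfl⟩
  rw [Metric.mem_ball, Subtype.dist_eq, Real.dist_eq, abs_lt]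
  exact ⟨by simp only; linarith, by simp only; linarith⟩

/-- The complement of the union of an enumerable family of rational intervals is a `Π⁰₁` class. -/
theorem RelEnum.isPiClass {A : Set ℕ} {p : ℚ × ℚ → Prop} (hp : RelEnum A p) :
    IsPiClass A {t | ¬ ∃ a b, p (a, b) ∧ t ∈ basicOpen a b} := by
  -- The parametrization theorem is applied with a dummy parameter, then evaluated at `0`.
  obtain ⟨s, -, hs⟩ := (hp.comp (f := Prod.snd (α := ℕ)) .snd).exists_index
  refine ⟨s (Encodable.encode 0), ?_⟩
  ext t
  simp only [Set.mem_compl_iff, Set.mem_ofPred_eq, not_not, sigmaClass, ← RatCode.encode_rat_pair, hs]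

/-- Enumerable inclusions of rational intervals in preimages under a computable function. -/
theorem IsComputableFunIn.exists_relEnum {A : Set ℕ} {f : unitInterval → ℝ}
    (hf : IsComputableFunIn A f) : ∃ E : (ℚ × ℚ) × (ℚ × ℚ) → Prop, RelEnum A E ∧
      (∀ u a b, E (u, (a, b)) → ∀ t ∈ basicOpen a b, f t ∈ Set.Ioo (u.1 : ℝ) u.2) ∧
      ∀ (u : ℚ × ℚ) (t : unitInterval), f t ∈ Set.Ioo (u.1 : ℝ) u.2 →
        ∃ c d : ℚ, t ∈ basicOpen c d ∧ ∀ a b, c ≤ a → b ≤ d → E (u, (a, b)) := by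
  obtain ⟨α, hα, e⟩ := hf
  have hα := RelComp.of_computableIn hα
  -- Closing under subintervals allows an enumerated interval to be shrunk later until further
  -- strict inequalities hold on it.
  refine ⟨fun x => ∃ y : ℚ × ℚ, ratPairCode y.1 y.2 ∈ ceSet A (α (ratPairCode x.1.1 x.1.2)) ∧
    y.1 ≤ x.2.1 ∧ x.2.2 ≤ y.2, ?_, ?_, ?_⟩
  · refine RelEnum.exists_of (p := fun z : ((ℚ × ℚ) × (ℚ × ℚ)) × (ℚ × ℚ) =>
      ratPairCode z.2.1 z.2.2 ∈ ceSet A (α (ratPairCode z.1.1.1 z.1.1.2)) ∧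
        z.2.1 ≤ z.1.2.1 ∧ z.1.2.2 ≤ z.2.2)
      (RelEnum.and ?_ (.of_relDec (RelDec.and (.rat_le ?_ ?_) (.rat_le ?_ ?_))))
    · refine (RelEnum.mem_ceSet A).comp (f := fun z : ((ℚ × ℚ) × (ℚ × ℚ)) × (ℚ × ℚ) =>
        (ratPairCode z.2.1 z.2.2, α (ratPairCode z.1.1.1 z.1.1.2))) (RelComp.pair ?_ (hα.comp ?_))
      · exact .of_primrec (Primrec.encode.comp Primrec.snd)
      · exact .of_primrec (Primrec.encode.comp (Primrec.fst.comp Primrec.fst))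
    · exact RelComp.fst.comp .snd
    · exact RelComp.fst.comp (RelComp.snd.comp .fst)
    · exact RelComp.snd.comp (RelComp.snd.comp .fst)
    · exact RelComp.snd.comp .snd
  · rintro ⟨u1, u2⟩ a b ⟨⟨c, d⟩, h, hc, hd⟩ t ⟨h1, h2⟩
    have : t ∈ f ⁻¹' Set.Ioo (u1 : ℝ) u2 := by
      rw [e]
      refine ⟨c, d, h, lt_of_le_of_lt ?_ h1, lt_of_lt_of_le h2 ?_⟩
      exacts [by exact_mod_cast hc, by exact_mod_cast hd]
    exact this
  · rintro ⟨u1, u2⟩ t ht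
    have : t ∈ f ⁻¹' Set.Ioo (u1 : ℝ) u2 := ht
    rw [e] at this
    obtain ⟨c, d, h, ht⟩ := this
    exact ⟨c, d, ht, fun a b ha hb => ⟨(c, d), h, ha, hb⟩⟩

/-- The points at which no forward difference quotient over a distance less than `δ`
exceeds `q`. -/
def slopeClass (f : unitInterval → ℝ) (q δ : ℚ) : Set unitInterval :=
  {t | ∀ s : unitInterval, t < s → (s : ℝ) - t < δ → f s - f t ≤ q * (s - t)}

/-- If `t` violates the condition, continuity of `f` provides a rational `s` that witnesses this,
together with rational bounds on `f` near `t` and near `s` that separate the values. The bound `q *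
(s - ·)` is affine, so checking it at both ends of an interval around `t` suffices, whatever the
sign of `q`. -/
theorem isPiClass_slopeClass {A : Set ℕ} {f : unitInterval → ℝ} (hf : IsComputableFunIn A f)
    (hc : Continuous f) (q δ : ℚ) : IsPiClass A (slopeClass f q δ) := by
  obtain ⟨E, hE, hE1, hE2⟩ := hf.exists_relEnum
  let T := ((ℚ × ℚ) × (ℚ × ℚ)) × (ℚ × (ℚ × ℚ))
  -- The components of `z` are `((a, b), (((u1, u2), (v1, v2)), (s, (e, g))))`: on `(a, b)` the
  -- values of `f` lie in `(u1, u2)`, on `(e, g) ∋ s` in `(v1, v2)`.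
  let p : (ℚ × ℚ) × T → Prop := fun z =>
    (E (z.2.1.1, z.1) ∧ E (z.2.1.2, z.2.2.2)) ∧
      ((z.2.2.2.1 < z.2.2.1 ∧ z.2.2.1 < z.2.2.2.2) ∧ (0 ≤ z.2.2.1 ∧ z.2.2.1 ≤ 1)) ∧
      (z.1.2 ≤ z.2.2.1 ∧ z.2.2.1 - z.1.1 < δ) ∧
      (q * (z.2.2.1 - z.1.1) < z.2.1.2.1 - z.2.1.1.2 ∧
        q * (z.2.2.1 - z.1.2) < z.2.1.2.1 - z.2.1.1.2)
  have hp : RelEnum A p := by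
    have ha : RelComp A fun z : (ℚ × ℚ) × T => z.1.1 := RelComp.fst.comp .fst
    have hb : RelComp A fun z : (ℚ × ℚ) × T => z.1.2 := RelComp.snd.comp .fst
    have h21 : RelComp A fun z : (ℚ × ℚ) × T => z.2.1 := RelComp.fst.comp .snd
    have h22 : RelComp A fun z : (ℚ × ℚ) × T => z.2.2 := RelComp.snd.comp .snd
    have hu : RelComp A fun z : (ℚ × ℚ) × T => z.2.1.1 := RelComp.fst.comp h21
    have hv : RelComp A fun z : (ℚ × ℚ) × T => z.2.1.2 := RelComp.snd.comp h21
    have hs : RelComp A fun z : (ℚ × ℚ) × T => z.2.2.1 := RelComp.fst.comp h22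
    have he : RelComp A fun z : (ℚ × ℚ) × T => z.2.2.2 := RelComp.snd.comp h22
    have hd : RelComp A fun z : (ℚ × ℚ) × T => z.2.1.2.1 - z.2.1.1.2 :=
      .comp₂ RatCode.primrec_rat_sub (RelComp.fst.comp hv) (RelComp.snd.comp hu)
    have hsa : RelComp A fun z : (ℚ × ℚ) × T => z.2.2.1 - z.1.1 :=
      .comp₂ RatCode.primrec_rat_sub hs ha
    have hsb : RelComp A fun z : (ℚ × ℚ) × T => z.2.2.1 - z.1.2 :=
      .comp₂ RatCode.primrec_rat_sub hs hb
    refine ((hE.comp (hu.pair .fst)).and (hE.comp (hv.pair he))).and (.of_relDec ?_)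
    exact (((RelDec.rat_lt (RelComp.fst.comp he) hs).and (.rat_lt hs (RelComp.snd.comp he))).and
      ((RelDec.rat_le (.const 0) hs).and (.rat_le hs (.const 1)))).and
      (((RelDec.rat_le hb hs).and (.rat_lt hsa (.const δ))).and
      ((RelDec.rat_lt (.comp₂ RatCode.primrec_rat_mul (.const q) hsa) hd).and
        (.rat_lt (.comp₂ RatCode.primrec_rat_mul (.const q) hsb) hd)))
  convert hp.exists_of.isPiClass using 1
  ext t
  simp only [slopeClass, Set.mem_ofPred_eq]
  rw [← not_iff_not, not_not]
  push Not
  constructor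
  · rintro ⟨s₀, h1, h2, h3⟩
    obtain ⟨s, ⟨h1, h2, h3⟩, r, hr⟩ := exists_rat_mem_of_isOpen
      (O := {s : unitInterval | (t : ℝ) < s ∧ (s : ℝ) - t < δ ∧ q * ((s : ℝ) - t) < f s - f t})
      (.and (isOpen_lt (by fun_prop) (by fun_prop)) (.and (isOpen_lt (by fun_prop) (by fun_prop))
        (isOpen_lt (by fun_prop) (by fun_prop)))) ⟨s₀, h1, h2, h3⟩
    -- The slack `f s - f t - m` is split in halves between `v1` and `u2`, so that `v1 - u2 > m > q
    -- * (s - t)`.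
    obtain ⟨m, hm1, hm2⟩ := exists_between h3
    obtain ⟨v1, hv1, hv1'⟩ := exists_rat_btwn (show f s - (f s - f t - m) / 2 < f s by linarith)
    obtain ⟨v2, hv2, -⟩ := exists_rat_btwn (show f s < f s + 1 by linarith)
    obtain ⟨u2, hu2, hu2'⟩ := exists_rat_btwn (show f t < f t + (f s - f t - m) / 2 by linarith)
    obtain ⟨u1, -, hu1⟩ := exists_rat_btwn (show f t - 1 < f t by linarith)
    obtain ⟨c, d, ⟨hct, htd⟩, hcd⟩ := hE2 (u1, u2) t ⟨hu1, hu2⟩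
    obtain ⟨e, g, ⟨hes, hsg⟩, heg⟩ := hE2 (v1, v2) s ⟨hv1', hv2⟩
    have hq : (q : ℝ) * (s - t) < v1 - u2 := by linarith
    have hcont : Continuous fun y : ℝ => (q : ℝ) * (s - y) := by fun_prop
    have hev : ∀ᶠ y in nhds (t : ℝ), (q : ℝ) * (s - y) < v1 - u2 :=
      hcont.continuousAt.eventually_lt continuousAt_const hq
    obtain ⟨ε, hε, hball⟩ := Metric.eventually_nhds_iff.1 hev
    obtain ⟨a, ha, ha'⟩ := exists_rat_btwn (show max (c : ℝ) (max ((s : ℝ) - δ) (t - ε)) < t by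
      simp only [max_lt_iff]; exact ⟨hct, by linarith, by linarith⟩)
    obtain ⟨b, hb', hb⟩ := exists_rat_btwn (show (t : ℝ) < min (d : ℝ) (min s (t + ε)) by
      simp only [lt_min_iff]; exact ⟨htd, h1, by linarith⟩)
    simp only [max_lt_iff] at ha
    simp only [lt_min_iff] at hb
    have hqa : (q : ℝ) * (s - a) < v1 - u2 := hball (by rw [Real.dist_eq, abs_lt]; constructor <;> linarith)
    have hqb : (q : ℝ) * (s - b) < v1 - u2 := hball (by rw [Real.dist_eq, abs_lt]; constructor <;> linarith)
    have hs0 := s.2.1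
    have hs1 := s.2.2
    rw [← hr] at hqa hqb hes hsg hs0 hs1 hb ha
    refine ⟨a, b, ⟨(((u1, u2), (v1, v2)), (r, (e, g))), ⟨hcd a b ?_ ?_, heg e g le_rfl le_rfl⟩,
      ⟨⟨?_, ?_⟩, ?_, ?_⟩, ⟨?_, ?_⟩, ?_, ?_⟩, ha', hb'⟩
    · exact_mod_cast ha.1.le
    · exact_mod_cast hb.1.le
    · exact_mod_cast hes
    · exact_mod_cast hsg
    · exact_mod_cast hs0
    · exact_mod_cast hs1
    · exact_mod_cast hb.2.1.le
    · have : (r : ℝ) - a < δ := by linarith [ha.2.1]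
      exact_mod_cast this
    · exact_mod_cast hqa
    · exact_mod_cast hqb
  · rintro ⟨a, b, ⟨⟨⟨⟨u1, u2⟩, ⟨v1, v2⟩⟩, ⟨r, ⟨e, g⟩⟩⟩, ⟨hu, hv⟩, ⟨⟨hes, hsg⟩, hs0, hs1⟩, ⟨hb, hd⟩, hqa, hqb⟩, hat, htb⟩
    simp only at hu hv hes hsg hs0 hs1 hb hd hqa hqb
    have hes : (e : ℝ) < r := by exact_mod_cast hes
    have hsg : (r : ℝ) < g := by exact_mod_cast hsg
    have hs0 : (0 : ℝ) ≤ r := by exact_mod_cast hs0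
    have hs1 : (r : ℝ) ≤ 1 := by exact_mod_cast hs1
    have hb : (b : ℝ) ≤ r := by exact_mod_cast hb
    have hd : (r : ℝ) - a < δ := by exact_mod_cast hd
    have hqa : (q : ℝ) * (r - a) < v1 - u2 := by exact_mod_cast hqa
    have hqb : (q : ℝ) * (r - b) < v1 - u2 := by exact_mod_cast hqb
    have h1 := hE1 _ _ _ hu t ⟨hat, htb⟩
    have h2 := hE1 _ _ _ hv ⟨r, hs0, hs1⟩ ⟨hes, hsg⟩
    simp only [Set.mem_Ioo] at h1 h2
    refine ⟨⟨r, hs0, hs1⟩, show (t : ℝ) < r by linarith, show (r : ℝ) - t < δ by linarith, ?_⟩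
    show (q : ℝ) * (r - t) < _
    have : (q : ℝ) * (r - t) < v1 - u2 := by
      -- Monotonicity of the affine bound in `t` reduces the claim to one of the ends `a`, `b`,
      -- chosen by the sign of `q`.
      rcases le_total 0 (q : ℝ) with h | h <;> nlinarith
    linarith [h1.2, h2.1]

-- Genericity turns membership of `x` in a slope class into membership in its interior, so forward
-- quotients are bounded at all nearby points. A backward quotient at `y` is a forward quotient at
-- the other point, hence is bounded too.
open Filter Topology in
theorem IsOneGenericIn.eventually_deriv_le {A : Set ℕ} {x : unitInterval} (hx : IsOneGenericIn A x)
    {f f' : unitInterval → ℝ} (hf : IsComputableFunIn A f) (hd : HasDerivOnUnit f f') {q : ℚ}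
    (hq : f' x < q) : ∀ᶠ y in 𝓝 x, f' y ≤ q := by
  have hext : ∀ s : unitInterval, Set.IccExtend (zero_le_one' ℝ) f s = f s := fun s => by simp
  obtain ⟨δ₀, hδ₀, h0⟩ := Metric.eventually_nhds_iff.1 (eventually_nhdsWithin_iff.1 ((hd x).limsup_slope_le hq))
  obtain ⟨δ, hδ, hδ'⟩ := exists_rat_btwn hδ₀
  have hmem : x ∈ slopeClass f q δ := by
    intro s hs hsδ
    have hs' : (x : ℝ) < s := hs
    have h := h0 (y := (s : ℝ)) (by rw [Real.dist_eq, abs_lt]; constructor <;> linarith) ⟨s.2, hs'.ne'⟩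
    rw [slope_def_field, div_lt_iff₀ (by linarith), hext, hext] at h
    exact h.le
  have hint : x ∈ interior (slopeClass f q δ) := by
    by_contra h
    exact hx _ (isPiClass_slopeClass hf hd.continuous q δ) ⟨hmem, h⟩
  -- Two points within `δ / 2` of `x` are less than `δ` apart.
  have hδ2 : (0 : ℝ) < δ / 2 := by linarith
  have hO : interior (slopeClass f q δ) ∩ Metric.ball x (δ / 2) ∈ 𝓝 x :=
    inter_mem (isOpen_interior.mem_nhds hint) (Metric.ball_mem_nhds x hδ2)
  filter_upwards [eventually_mem_nhds_iff.2 hO] with y hy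
  have hty : Tendsto (slope (Set.IccExtend (zero_le_one' ℝ) f) y) (𝓝[Set.Icc 0 1 \ {(y : ℝ)}] y) (𝓝 (f' y)) :=
    hasDerivWithinAt_iff_tendsto_slope.1 (hd y)
  have hne : (𝓝[Set.Icc 0 1 \ {(y : ℝ)}] (y : ℝ)).NeBot := by
    have := (uniqueDiffOn_Icc (zero_lt_one' ℝ)) y y.2
    exact accPt_principal_iff_nhdsWithin.1 this.accPt
  have hy2 : ∀ᶠ z in 𝓝 (y : ℝ), ∀ hz : z ∈ Set.Icc (0 : ℝ) 1,
      (⟨z, hz⟩ : unitInterval) ∈ interior (slopeClass f q δ) ∩ Metric.ball x (δ / 2) := by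
    rw [nhds_subtype_eq_comap] at hy
    obtain ⟨S, hS, hSy⟩ := hy
    filter_upwards [hS] with z hz hz'
    exact hSy hz
  have hyy := mem_of_mem_nhds hy
  refine le_of_tendsto hty (eventually_nhdsWithin_iff.2 (hy2.mono fun z hz hzm => ?_))
  obtain ⟨hz1, hz2⟩ := hz hzm.1
  have hd1 := abs_lt.1 ((Real.dist_eq _ _).symm.trans_lt (show dist z (x : ℝ) < δ / 2 from hz2))
  have hd2 := abs_lt.1 ((Real.dist_eq _ _).symm.trans_lt (show dist (y : ℝ) (x : ℝ) < δ / 2 from hyy.2))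
  rcases lt_or_gt_of_ne hzm.2 with h | h
  · have := interior_subset hz1 y h (show (y : ℝ) - z < δ by linarith)
    rw [slope_comm, slope_def_field, div_le_iff₀ (by linarith), hext, hext ⟨z, hzm.1⟩]
    exact this
  · have := interior_subset hyy.1 ⟨z, hzm.1⟩ h (show z - (y : ℝ) < δ by linarith)
    rw [slope_def_field, div_le_iff₀ (by linarith), hext, hext ⟨z, hzm.1⟩]
    exact this

/-- The derivative of a computable differentiable function is continuous at 1-generic points. -/
theorem IsOneGenericIn.continuousAt_deriv {A : Set ℕ} {x : unitInterval} (hx : IsOneGenericIn A x)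
    {f f' : unitInterval → ℝ} (hf : IsComputableFunIn A f) (hd : HasDerivOnUnit f f') :
    ContinuousAt f' x := by
  refine tendsto_order.2 ⟨fun c hc => ?_, fun c hc => ?_⟩
  · obtain ⟨q, h1, h2⟩ := exists_rat_btwn hc
    have := hx.eventually_deriv_le hf.neg hd.neg (q := -q) (by push_cast; linarith)
    filter_upwards [this] with y hy
    push_cast at hy
    linarith
  · obtain ⟨q, h1, h2⟩ := exists_rat_btwn hc
    filter_upwards [hx.eventually_deriv_le hf hd h1] with y hy
    linarith

/-! ### Sums of small bumps over dyadic cells -/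

section Bump

variable {K : Type*} [Field K] [LinearOrder K]

/-- The continuously differentiable bump `max(0, 1 - v²)²`. -/
def bumpShape (v : K) : K := max 0 (1 - v ^ 2) ^ 2

/-- The bump of height and radius `2^(-4n-2)` around the midpoint of the dyadic interval
`[k/2^n, (k+1)/2^n]`. -/
def cellBump (n k : ℕ) (t : K) : K :=
  ((2 ^ (4 * n + 2) : ℕ) : K)⁻¹ *
    bumpShape ((t - ((2 * k + 1 : ℕ) : K) * ((2 ^ (n + 1) : ℕ) : K)⁻¹) * ((2 ^ (4 * n + 2) : ℕ) : K))

open Classical in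
/-- The sum of the bumps in the dyadic intervals of length `2^(-n)` that are selected by `S`. -/
noncomputable def bumpLayer (S : ℕ → ℕ → Prop) (n : ℕ) (t : K) : K :=
  ∑ k ∈ Finset.range (2 ^ n), if S n k then cellBump n k t else 0

/-- The sum of the first `N` layers of bumps. -/
noncomputable def bumpSum (S : ℕ → ℕ → Prop) (N : ℕ) (t : K) : K :=
  ∑ n ∈ Finset.range N, bumpLayer S n t

end Bump

/-- This is why the bumps are defined over an arbitrary ordered field: one formula is computed over
`ℚ` and differentiated over `ℝ`. -/
theorem cast_bumpSum (S : ℕ → ℕ → Prop) (N : ℕ) (a : ℚ) :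
    ((bumpSum S N a : ℚ) : ℝ) = bumpSum S N (a : ℝ) := by
  simp only [bumpSum, bumpLayer, cellBump, bumpShape]
  push_cast [apply_ite (Rat.cast : ℚ → ℝ)]
  rfl

section Real

theorem bumpShape_nonneg (v : ℝ) : 0 ≤ bumpShape v := sq_nonneg _

theorem bumpShape_le_one (v : ℝ) : bumpShape v ≤ 1 :=
  pow_le_one₀ (le_max_left _ _) (max_le zero_le_one (by linarith [sq_nonneg v]))

theorem bumpShape_eq_zero {v : ℝ} (h : 1 ≤ |v|) : bumpShape v = 0 := by
  have : 1 ≤ v ^ 2 := by rw [← sq_abs]; nlinarith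
  rw [bumpShape, max_eq_left (by linarith)]
  simp

open Filter Topology in
theorem hasDerivAt_max_zero_sq (y : ℝ) : HasDerivAt (fun y : ℝ => max 0 y ^ 2) (2 * max 0 y) y := by
  rcases lt_trichotomy y 0 with h | rfl | h
  · rw [max_eq_left h.le, mul_zero]
    refine (hasDerivAt_const y (0 : ℝ)).congr_of_eventuallyEq ?_
    filter_upwards [Iio_mem_nhds h] with z hz
    rw [max_eq_left (le_of_lt hz)]
    simp
  · rw [max_self, mul_zero]
    have : (fun y : ℝ => max 0 y ^ 2) =O[𝓝 0] fun y => ‖y - 0‖ ^ 2 := by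
      refine Asymptotics.IsBigO.of_bound 1 (Eventually.of_forall fun z => ?_)
      simp only [one_mul, sub_zero, Real.norm_eq_abs, sq_abs, abs_pow]
      rcases le_total z 0 with hz | hz
      · rw [max_eq_left hz]; nlinarith
      · rw [max_eq_right hz]
    exact (this.hasFDerivAt one_lt_two).hasDerivAt
  · rw [max_eq_right h.le]
    refine (by simpa using hasDerivAt_pow 2 y : HasDerivAt (fun y : ℝ => y ^ 2) (2 * y) y).congr_of_eventuallyEq ?_
    filter_upwards [Ioi_mem_nhds h] with z hz
    rw [max_eq_right (le_of_lt hz)]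

theorem hasDerivAt_bumpShape (v : ℝ) :
    HasDerivAt bumpShape (2 * max 0 (1 - v ^ 2) * (-(2 * v))) v := by
  have h : HasDerivAt (fun v : ℝ => 1 - v ^ 2) (-(2 * v)) v := by
    simpa using (hasDerivAt_pow 2 v).const_sub 1
  exact (hasDerivAt_max_zero_sq (1 - v ^ 2)).comp v h

theorem abs_bumpShape_sub_le (u v : ℝ) : |bumpShape u - bumpShape v| ≤ 4 * |u - v| := by
  refine convex_univ.norm_image_sub_le_of_norm_hasDerivWithin_le
    (fun x _ => (hasDerivAt_bumpShape x).hasDerivWithinAt) (fun x _ => ?_) (Set.mem_univ v) (Set.mem_univ u)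
  rw [Real.norm_eq_abs, abs_le]
  rcases le_total (1 - x ^ 2) 0 with h | h
  · rw [max_eq_left h]; norm_num
  · rw [max_eq_right h]
    have h1 : |x| ≤ 1 := by rw [← abs_one, ← sq_le_sq]; linarith
    obtain ⟨h2, h3⟩ := abs_le.1 h1
    constructor <;> nlinarith [sq_nonneg x, mul_nonneg h (by linarith : 0 ≤ 1 + x), mul_nonneg h (by linarith : 0 ≤ 1 - x)]

/-! ### A single bump and the geometry of dyadic cells. -/

variable (n k : ℕ)

theorem cellBump_nonneg (t : ℝ) : 0 ≤ cellBump n k t :=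
  mul_nonneg (by positivity) (bumpShape_nonneg _)

theorem cellBump_le (t : ℝ) : cellBump n k t ≤ ((2 ^ (4 * n + 2) : ℕ) : ℝ)⁻¹ :=
  mul_le_of_le_one_right (by positivity) (bumpShape_le_one _)

theorem differentiable_cellBump : Differentiable ℝ (cellBump n k : ℝ → ℝ) := by
  have h : Differentiable ℝ (bumpShape : ℝ → ℝ) := fun v => (hasDerivAt_bumpShape v).differentiableAt
  unfold cellBump
  fun_prop

/-- Height and radius are equal, so rescaling preserves the Lipschitz constant `4` of the shape. -/
theorem abs_cellBump_sub_le (s t : ℝ) : |cellBump n k s - cellBump n k t| ≤ 4 * |s - t| := by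
  have hM : (0 : ℝ) < ((2 ^ (4 * n + 2) : ℕ) : ℝ) := by positivity
  unfold cellBump
  rw [← mul_sub, abs_mul, abs_of_pos (inv_pos.2 hM), inv_mul_le_iff₀ hM]
  refine (abs_bumpShape_sub_le _ _).trans_eq ?_
  rw [← sub_mul, sub_sub_sub_cancel_right, abs_mul, abs_of_pos hM]
  ring

theorem cellBump_mid :
    cellBump n k (((2 * k + 1 : ℕ) : ℝ) * ((2 ^ (n + 1) : ℕ) : ℝ)⁻¹) = ((2 ^ (4 * n + 2) : ℕ) : ℝ)⁻¹ := by
  simp [cellBump, bumpShape]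

theorem cellBump_eq_zero {t : ℝ} (h : ((2 ^ (4 * n + 2) : ℕ) : ℝ)⁻¹ ≤
    |t - ((2 * k + 1 : ℕ) : ℝ) * ((2 ^ (n + 1) : ℕ) : ℝ)⁻¹|) : cellBump n k t = 0 := by
  have hM : (0 : ℝ) < ((2 ^ (4 * n + 2) : ℕ) : ℝ) := by positivity
  rw [cellBump, bumpShape_eq_zero, mul_zero]
  rw [abs_mul, abs_of_pos hM]
  rwa [inv_le_iff_one_le_mul₀ hM] at h

/-- The closed dyadic interval `[k/2^n, (k+1)/2^n]`. -/
def dyadicCell (n k : ℕ) : Set ℝ := Set.Icc ((k : ℝ) / 2 ^ n) (((k : ℝ) + 1) / 2 ^ n)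

/-- The interior of a dyadic interval. -/
def openCell (n k : ℕ) : Set ℝ := Set.Ioo ((k : ℝ) / 2 ^ n) (((k : ℝ) + 1) / 2 ^ n)

theorem openCell_subset : openCell n k ⊆ dyadicCell n k := Set.Ioo_subset_Icc_self

theorem dyadicCell_subset {m d k j : ℕ} (h1 : j * 2 ^ d ≤ k) (h2 : k + 1 ≤ (j + 1) * 2 ^ d) :
    dyadicCell (m + d) k ⊆ dyadicCell m j := by
  have h1' : (j : ℝ) * 2 ^ d ≤ k := by exact_mod_cast h1
  have h2' : (k : ℝ) + 1 ≤ (j + 1) * 2 ^ d := by exact_mod_cast h2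
  refine Set.Icc_subset_Icc ?_ ?_
  · rw [div_le_div_iff₀ (by positivity) (by positivity), pow_add]
    nlinarith [pow_pos (two_pos : (0 : ℝ) < 2) m]
  · rw [div_le_div_iff₀ (by positivity) (by positivity), pow_add]
    nlinarith [pow_pos (two_pos : (0 : ℝ) < 2) m]

/-- Dyadic intervals are nested or have disjoint interiors. A common interior point is required
because neighbouring closed cells share an end. -/
theorem dyadicCell_subset_of_mem {m n j k : ℕ} {s : ℝ} (hmn : m ≤ n) (hk : s ∈ openCell n k)
    (hj : s ∈ openCell m j) : dyadicCell n k ⊆ dyadicCell m j := by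
  obtain ⟨d, rfl⟩ := Nat.exists_eq_add_of_le hmn
  have h1 := hj.1.trans hk.2
  have h2 := hk.1.trans hj.2
  have hp := pow_pos (two_pos : (0 : ℝ) < 2) m
  rw [div_lt_div_iff₀ (by positivity) (by positivity), pow_add, mul_comm (2 ^ m), ← mul_assoc] at h1 h2
  have h1' : (j : ℝ) * 2 ^ d < k + 1 := lt_of_mul_lt_mul_right h1 hp.le
  have h2' : (k : ℝ) < (j + 1) * 2 ^ d := lt_of_mul_lt_mul_right h2 hp.le
  refine dyadicCell_subset ?_ ?_
  · exact Nat.lt_succ_iff.1 (by exact_mod_cast h1')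
  · exact_mod_cast h2'

theorem openCell_subset_half : openCell (n + 1) k ⊆ openCell n (k / 2) := by
  have h1 : ((k / 2 : ℕ) : ℝ) * 2 ≤ k := by exact_mod_cast Nat.div_mul_le_self k 2
  have h2 : (k : ℝ) + 1 ≤ ((k / 2 : ℕ) + 1) * 2 := by
    have : k + 1 ≤ (k / 2 + 1) * 2 := by omega
    exact_mod_cast this
  have hp := pow_pos (two_pos : (0 : ℝ) < 2) n
  refine Set.Ioo_subset_Ioo ?_ ?_ <;>
  · rw [div_le_div_iff₀ (by positivity) (by positivity), pow_succ]
    nlinarith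

theorem cell_eq_of_mem {j k : ℕ} {s : ℝ} (hk : s ∈ openCell n k) (hj : s ∈ openCell n j) : j = k := by
  have hp := pow_pos (two_pos : (0 : ℝ) < 2) n
  have h1 := (div_lt_div_iff_of_pos_right hp).1 (hj.1.trans hk.2)
  have h2 := (div_lt_div_iff_of_pos_right hp).1 (hk.1.trans hj.2)
  have h1' : j < k + 1 := by exact_mod_cast h1
  have h2' : k < j + 1 := by exact_mod_cast h2
  omega

theorem abs_sub_le_of_mem_dyadicCell {s t : ℝ} (hs : s ∈ dyadicCell n k) (ht : t ∈ dyadicCell n k) :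
    |s - t| ≤ (1 / 2) ^ n := by
  have e : ((k : ℝ) + 1) / 2 ^ n = (k : ℝ) / 2 ^ n + (1 / 2) ^ n := by
    rw [add_div, one_div_pow]
  obtain ⟨h1, h2⟩ := hs
  obtain ⟨h3, h4⟩ := ht
  rw [abs_le]
  constructor <;> linarith

theorem cell_mid_sub : ((2 * k + 1 : ℕ) : ℝ) * ((2 ^ (n + 1) : ℕ) : ℝ)⁻¹ = (k : ℝ) / 2 ^ n + (1 / 2) ^ n / 2 := by
  rw [one_div_pow]
  push_cast
  field_simp
  ring

theorem bump_radius_eq : ((2 ^ (4 * n + 2) : ℕ) : ℝ)⁻¹ = ((1 / 2) ^ n) ^ 4 / 4 := by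
  rw [one_div_pow]
  push_cast
  rw [pow_add, pow_mul']
  field_simp
  norm_num

theorem bump_radius_le : ((2 ^ (4 * n + 2) : ℕ) : ℝ)⁻¹ ≤ (1 / 2) ^ n / 4 := by
  rw [bump_radius_eq]
  have h0 : (0 : ℝ) ≤ (1 / 2) ^ n := by positivity
  have h1 : ((1 : ℝ) / 2) ^ n ≤ 1 := pow_le_one₀ (by norm_num) (by norm_num)
  have := pow_le_of_le_one h0 h1 (n := 4) (by norm_num)
  linarith

/-- The radius is at most a quarter of the cell's length, so the bump occupies at most the middle
half and keeps a quarter of the length away from everything outside the cell. -/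
theorem mem_openCell_of_abs {t : ℝ}
    (h : |t - ((2 * k + 1 : ℕ) : ℝ) * ((2 ^ (n + 1) : ℕ) : ℝ)⁻¹| ≤ ((2 ^ (4 * n + 2) : ℕ) : ℝ)⁻¹) :
    t ∈ openCell n k ∧ ∀ x ∉ dyadicCell n k, (1 / 2) ^ n / 4 ≤ |t - x| := by
  have h := abs_le.1 (h.trans (bump_radius_le n))
  rw [cell_mid_sub] at h
  have hp : (0 : ℝ) < (1 / 2) ^ n := by positivity
  have e : ((k : ℝ) + 1) / 2 ^ n = (k : ℝ) / 2 ^ n + (1 / 2) ^ n := by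
    rw [add_div, one_div_pow]
  refine ⟨⟨by linarith, by linarith⟩, fun x hx => ?_⟩
  rw [dyadicCell, Set.mem_Icc, not_and_or, not_le, not_le] at hx
  rcases hx with hx | hx
  · exact le_trans (by linarith) (le_abs_self _)
  · exact le_trans (by linarith) (neg_le_abs _)

theorem abs_le_of_cellBump_ne_zero {t : ℝ} (h : cellBump n k t ≠ 0) :
    |t - ((2 * k + 1 : ℕ) : ℝ) * ((2 ^ (n + 1) : ℕ) : ℝ)⁻¹| ≤ ((2 ^ (4 * n + 2) : ℕ) : ℝ)⁻¹ := by
  by_contra hlt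
  exact h (cellBump_eq_zero n k (not_le.1 hlt).le)

/-! ### Layers of bumps: size, Lipschitz and tail bounds. -/

variable (S : ℕ → ℕ → Prop)

theorem bumpLayer_nonneg (t : ℝ) : 0 ≤ bumpLayer S n t := by
  refine Finset.sum_nonneg fun k _ => ?_
  split_ifs
  exacts [cellBump_nonneg n k t, le_rfl]

/-- The crude sum of all `2^n` heights is enough; the exponent `4 * n + 2` leaves the cubic decay
that the quadratic bound on the series needs. -/
theorem bumpLayer_le (t : ℝ) : bumpLayer S n t ≤ ((1 / 2) ^ n) ^ 3 / 4 := by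
  have h : bumpLayer S n t ≤ ∑ k ∈ Finset.range (2 ^ n), ((2 ^ (4 * n + 2) : ℕ) : ℝ)⁻¹ := by
    refine Finset.sum_le_sum fun k _ => ?_
    split_ifs
    exacts [cellBump_le n k t, by positivity]
  refine h.trans_eq ?_
  rw [Finset.sum_const, Finset.card_range, nsmul_eq_mul, bump_radius_eq, one_div_pow]
  push_cast
  field_simp

theorem bumpLayer_le_geometric (t : ℝ) : bumpLayer S n t ≤ 1 / 2 / 2 ^ n := by
  refine (bumpLayer_le n S t).trans ?_
  have h0 : (0 : ℝ) ≤ (1 / 2) ^ n := by positivity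
  have h1 : ((1 : ℝ) / 2) ^ n ≤ 1 := pow_le_one₀ (by norm_num) (by norm_num)
  have := pow_le_of_le_one h0 h1 (n := 3) (by norm_num)
  rw [div_div, mul_comm, ← div_div, ← one_div_pow]
  linarith

theorem exists_of_bumpLayer_ne_zero {t : ℝ} (h : bumpLayer S n t ≠ 0) :
    ∃ k, S n k ∧ cellBump n k t ≠ 0 := by
  obtain ⟨k, -, hk⟩ := Finset.exists_ne_zero_of_sum_ne_zero h
  split_ifs at hk with h'
  exacts [⟨k, h', hk⟩, (hk rfl).elim]

theorem summable_bumpLayer (t : ℝ) : Summable fun n => bumpLayer S n t :=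
  Summable.of_nonneg_of_le (fun n => bumpLayer_nonneg n S t) (fun n => bumpLayer_le_geometric n S t)
    (summable_geometric_two' 1)

theorem differentiable_bumpSum (N : ℕ) : Differentiable ℝ (bumpSum S N : ℝ → ℝ) := by
  unfold bumpSum bumpLayer
  refine Differentiable.fun_sum fun n _ => Differentiable.fun_sum fun k _ => ?_
  split_ifs
  exacts [differentiable_cellBump n k, differentiable_const 0]

theorem abs_bumpLayer_sub_le (s t : ℝ) :
    |bumpLayer S n s - bumpLayer S n t| ≤ 2 ^ n * (4 * |s - t|) := by
  unfold bumpLayer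
  rw [← Finset.sum_sub_distrib]
  refine (Finset.abs_sum_le_sum_abs _ _).trans ?_
  have : ((2 : ℝ) ^ n * (4 * |s - t|)) = ∑ k ∈ Finset.range (2 ^ n), 4 * |s - t| := by
    rw [Finset.sum_const, Finset.card_range, nsmul_eq_mul]
    push_cast
    rfl
  rw [this]
  refine Finset.sum_le_sum fun k _ => ?_
  split_ifs
  · exact abs_cellBump_sub_le n k s t
  · rw [sub_self, abs_zero]; positivity

/-- Disjointness of the bumps would give a better constant, but computability needs only an explicit
one. -/
theorem abs_bumpSum_sub_le (N : ℕ) (s t : ℝ) :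
    |bumpSum S N s - bumpSum S N t| ≤ 2 ^ N * (4 * |s - t|) := by
  induction N with
  | zero => simp only [bumpSum, Finset.range_zero, Finset.sum_empty, sub_self, abs_zero]; positivity
  | succ N ih =>
    unfold bumpSum at ih ⊢
    rw [Finset.sum_range_succ, Finset.sum_range_succ, add_sub_add_comm]
    refine (abs_add_le _ _).trans ?_
    have := abs_bumpLayer_sub_le N S s t
    rw [pow_succ]
    linarith

/-- The sum of all selected bumps. -/
noncomputable def bumpSeries (t : ℝ) : ℝ := ∑' n, bumpLayer S n t

theorem abs_bumpSeries_sub_bumpSum_le (N : ℕ) (t : ℝ) :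
    |bumpSeries S t - bumpSum S N t| ≤ (1 / 2) ^ N := by
  have h := (summable_bumpLayer S t).sum_add_tsum_nat_add N
  have e : bumpSeries S t - bumpSum S N t = ∑' n, bumpLayer S (n + N) t := by
    unfold bumpSeries bumpSum
    linarith
  rw [e, abs_of_nonneg (tsum_nonneg fun n => bumpLayer_nonneg _ S t)]
  have hg : HasSum (fun n : ℕ => (1 / 2 : ℝ) ^ N / 2 / 2 ^ n) ((1 / 2) ^ N) := hasSum_geometric_two' _
  refine (Summable.tsum_le_tsum (fun n => ?_) ((summable_nat_add_iff N).2 (summable_bumpLayer S t))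
    hg.summable).trans_eq hg.tsum_eq
  refine (bumpLayer_le_geometric _ S t).trans_eq ?_
  rw [one_div_pow, pow_add]
  field_simp

end Real

/-! ### Bumps in the dyadic cells of an open set -/

section Selected

/-- The dyadic interval with index `(n, k)` is contained in one of the first `n` intervals `I i`. -/
def covered (I : ℕ → Set ℝ) (n k : ℕ) : Prop := ∃ i < n, dyadicCell n k ⊆ I i

/-- A dyadic interval is selected when it is covered and its parent is not. -/
def selected (I : ℕ → Set ℝ) (n k : ℕ) : Prop := covered I n k ∧ ¬ covered I (n - 1) (k / 2)

variable {I : ℕ → Set ℝ}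

theorem covered.mono {m n j k : ℕ} (h : covered I m j) (hmn : m ≤ n)
    (hs : dyadicCell n k ⊆ dyadicCell m j) : covered I n k := by
  obtain ⟨i, hi, hI⟩ := h
  exact ⟨i, hi.trans_le hmn, hs.trans hI⟩

theorem covered.subset {n k : ℕ} (h : covered I n k) : dyadicCell n k ⊆ ⋃ i, I i := by
  obtain ⟨i, -, hI⟩ := h
  exact hI.trans (Set.subset_iUnion I i)

/-- Coverage passes to subintervals of higher level, so a covered cell of smaller level around `s`
would cover the parent of the selected one. Nothing is covered at level `0`, so a selected cell
always has a genuine parent. -/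
theorem selected.le_of_covered {m n j k : ℕ} {s : ℝ} (hm : covered I m j) (hn : selected I n k)
    (hj : s ∈ openCell m j) (hk : s ∈ openCell n k) : n ≤ m := by
  by_contra! hlt
  obtain ⟨l, rfl⟩ : ∃ l, n = l + 1 := ⟨n - 1, by omega⟩
  exact hn.2 (hm.mono (by omega) (dyadicCell_subset_of_mem (by omega) (openCell_subset_half l k hk) hj))

theorem selected.unique {m n j k : ℕ} {s : ℝ} (hm : selected I m j) (hn : selected I n k)
    (hj : s ∈ openCell m j) (hk : s ∈ openCell n k) : m = n ∧ j = k := by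
  obtain rfl : m = n :=
    le_antisymm (selected.le_of_covered hn.1 hm hk hj) (selected.le_of_covered hm.1 hn hj hk)
  exact ⟨rfl, cell_eq_of_mem m hk hj⟩

theorem bumpLayer_eq_cellBump {n k : ℕ} {s : ℝ} (hn : selected I n k) (hk : k < 2 ^ n)
    (hs : s ∈ openCell n k) : bumpLayer (selected I) n s = cellBump n k s := by
  unfold bumpLayer
  rw [Finset.sum_eq_single_of_mem k (Finset.mem_range.2 hk), if_pos hn]
  intro j _ hj
  split_ifs with h
  · by_contra h0
    exact hj (h.unique hn (mem_openCell_of_abs n j (abs_le_of_cellBump_ne_zero n j h0)).1 hs).2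
  · rfl

theorem bumpSeries_eq_cellBump {n k : ℕ} {s : ℝ} (hn : selected I n k) (hk : k < 2 ^ n)
    (hs : s ∈ openCell n k) : bumpSeries (selected I) s = cellBump n k s := by
  rw [bumpSeries, tsum_eq_single n, bumpLayer_eq_cellBump hn hk hs]
  intro m hm
  by_contra h0
  obtain ⟨j, hj, h1⟩ := exists_of_bumpLayer_ne_zero m _ h0
  exact hm (hj.unique hn (mem_openCell_of_abs m j (abs_le_of_cellBump_ne_zero m j h1)).1 hs).1

theorem bumpSeries_nonneg (S : ℕ → ℕ → Prop) (t : ℝ) : 0 ≤ bumpSeries S t :=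
  tsum_nonneg fun n => bumpLayer_nonneg n S t

/-- If layer `n` is nonzero at `t`, then `t` lies on a bump in a cell that avoids `x`, so `|t - x| ≥
2^(-n) / 4`. The layer is at most `2^(-3n) / 4`, hence at most `4 (t - x)² 2^(-n)`, and these bounds
sum to `8 (t - x)²`. -/
theorem bumpSeries_le_sq {x : ℝ} (hx : x ∉ ⋃ i, I i) (t : ℝ) :
    bumpSeries (selected I) t ≤ 8 * (t - x) ^ 2 := by
  have hg : HasSum (fun n : ℕ => 8 * (t - x) ^ 2 / 2 / 2 ^ n) (8 * (t - x) ^ 2) := hasSum_geometric_two' _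
  refine (Summable.tsum_le_tsum (fun n => ?_) (summable_bumpLayer _ t) hg.summable).trans_eq hg.tsum_eq
  by_cases h0 : bumpLayer (selected I) n t = 0
  · rw [h0]; positivity
  · obtain ⟨k, hk, h1⟩ := exists_of_bumpLayer_ne_zero n _ h0
    have h2 := (mem_openCell_of_abs n k (abs_le_of_cellBump_ne_zero n k h1)).2 x
      fun h => hx (hk.1.subset h)
    have hp : (0 : ℝ) < (1 / 2) ^ n := by positivity
    have h3 : ((1 / 2 : ℝ) ^ n / 4) ^ 2 ≤ (t - x) ^ 2 := by
      rw [← sq_abs (t - x)]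
      exact pow_le_pow_left₀ (by positivity) h2 2
    refine (bumpLayer_le n _ t).trans ?_
    have e : 8 * (t - x) ^ 2 / 2 / 2 ^ n = 4 * (t - x) ^ 2 * (1 / 2) ^ n := by
      rw [one_div_pow]; ring
    rw [e]
    nlinarith

theorem hasDerivAt_bumpSeries_zero {x : ℝ} (hx : x ∉ ⋃ i, I i) :
    HasDerivAt (bumpSeries (selected I)) 0 x := by
  have : bumpSeries (selected I) =O[nhds x] fun t => ‖t - x‖ ^ 2 := by
    refine Asymptotics.IsBigO.of_bound 8 (Filter.Eventually.of_forall fun t => ?_)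
    simp only [Real.norm_eq_abs, sq_abs, abs_pow]
    rw [abs_of_nonneg (bumpSeries_nonneg _ t)]
    exact bumpSeries_le_sq hx t
  exact (this.hasFDerivAt one_lt_two).hasDerivAt

/-- Near a point of `I i`, cells of high level have parents that are short enough to lie in `I i`
and of level above `i`. Such parents are covered, so these cells are not selected, and the series is
locally a finite sum. -/
theorem differentiableAt_bumpSeries (hI : ∀ i, IsOpen (I i)) (x : ℝ) :
    DifferentiableAt ℝ (bumpSeries (selected I)) x := by
  by_cases hx : x ∈ ⋃ i, I i
  swap
  · exact (hasDerivAt_bumpSeries_zero hx).differentiableAt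
  obtain ⟨i, hi⟩ := Set.mem_iUnion.1 hx
  obtain ⟨δ, hδ, hb⟩ := Metric.isOpen_iff.1 (hI i) x hi
  obtain ⟨N, hN⟩ := exists_pow_lt_of_lt_one (half_pos hδ) (by norm_num : (1 / 2 : ℝ) < 1)
  refine (differentiable_bumpSum (selected I) (N + i + 2) x).congr_of_eventuallyEq ?_
  filter_upwards [Metric.ball_mem_nhds x (half_pos hδ)] with s hs
  refine tsum_eq_sum fun n hn => ?_
  rw [Finset.mem_range, not_lt] at hn
  by_contra h0
  obtain ⟨k, hk, h1⟩ := exists_of_bumpLayer_ne_zero n _ h0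
  have hs1 := (mem_openCell_of_abs n k (abs_le_of_cellBump_ne_zero n k h1)).1
  obtain ⟨l, rfl⟩ : ∃ l, n = l + 1 := ⟨n - 1, by omega⟩
  refine hk.2 ⟨i, by omega, fun y hy => hb ?_⟩
  have h2 := abs_sub_le_of_mem_dyadicCell l (k / 2) hy (openCell_subset _ _ (openCell_subset_half l k hs1))
  have h3 : ((1 : ℝ) / 2) ^ l ≤ (1 / 2) ^ N :=
    pow_le_pow_of_le_one (by norm_num) (by norm_num) (by omega)
  rw [Metric.mem_ball] at hs ⊢
  calc dist y x ≤ dist y s + dist s x := dist_triangle _ _ _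
    _ < δ := by rw [Real.dist_eq y s]; linarith

/-- Every nonnegative real lies in the dyadic interval given by the floor function. -/
theorem mem_dyadicCell_floor (n : ℕ) {s : ℝ} (hs : 0 ≤ s) : s ∈ dyadicCell n ⌊s * 2 ^ n⌋₊ := by
  have hp := pow_pos (two_pos : (0 : ℝ) < 2) n
  refine ⟨?_, ?_⟩
  · rw [div_le_iff₀ hp]
    exact Nat.floor_le (by positivity)
  · rw [le_div_iff₀ hp]
    exact (Nat.lt_floor_add_one _).le

theorem floor_pow_add_div (n d : ℕ) (s : ℝ) : ⌊s * 2 ^ (n + d)⌋₊ / 2 ^ d = ⌊s * 2 ^ n⌋₊ := by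
  rw [← Nat.floor_div_natCast]
  congr 1
  push_cast
  rw [pow_add]
  field_simp

theorem dyadicCell_floor_subset (n d : ℕ) (s : ℝ) :
    dyadicCell (n + d) ⌊s * 2 ^ (n + d)⌋₊ ⊆ dyadicCell n ⌊s * 2 ^ n⌋₊ := by
  have h : 0 < 2 ^ d := by positivity
  rw [← floor_pow_add_div n d s]
  exact dyadicCell_subset (Nat.div_mul_le_self _ _) (Nat.lt_div_mul_add h |>.trans_eq (by ring))

-- When `x` is a dyadic point and `s` is just below it, the cell of `s` ends at `x`; closed cells
-- make the claim hold from both sides.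
open Filter Topology in
theorem eventually_mem_dyadicCell_floor (n : ℕ) {x : ℝ} (hx : 0 ≤ x) :
    ∀ᶠ s in 𝓝 x, 0 ≤ s → x ∈ dyadicCell n ⌊s * 2 ^ n⌋₊ := by
  have hp := pow_pos (two_pos : (0 : ℝ) < 2) n
  have hT : Tendsto (fun s : ℝ => s * 2 ^ n) (𝓝 x) (𝓝 (x * 2 ^ n)) :=
    (continuous_id.mul continuous_const).tendsto x
  have h1 : ∀ᶠ y : ℝ in 𝓝 (x * 2 ^ n), y < (⌊x * 2 ^ n⌋₊ : ℝ) + 1 := Iio_mem_nhds (Nat.lt_floor_add_one _)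
  have h2 : ∀ᶠ y : ℝ in 𝓝 (x * 2 ^ n), (⌈x * 2 ^ n⌉₊ : ℝ) - 1 < y :=
    Ioi_mem_nhds (by linarith [Nat.ceil_lt_add_one (show 0 ≤ x * 2 ^ n by positivity)])
  filter_upwards [hT h1, hT h2] with s h1 h2 hs
  refine ⟨?_, ?_⟩
  · rw [div_le_iff₀ hp]
    have : ⌊s * 2 ^ n⌋₊ < ⌊x * 2 ^ n⌋₊ + 1 := by
      rw [Nat.floor_lt (by positivity)]
      push_cast
      exact h1
    exact (Nat.cast_le.2 (Nat.lt_succ_iff.1 this)).trans (Nat.floor_le (by positivity))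
  · rw [le_div_iff₀ hp]
    have h3 : (⌈x * 2 ^ n⌉₊ : ℝ) < ⌊s * 2 ^ n⌋₊ + 1 + 1 := by
      have h2' : (⌈x * 2 ^ n⌉₊ : ℝ) - 1 < s * 2 ^ n := h2
      linarith [Nat.lt_floor_add_one (s * 2 ^ n)]
    have h4 : ⌈x * 2 ^ n⌉₊ < ⌊s * 2 ^ n⌋₊ + 1 + 1 := by exact_mod_cast h3
    refine (Nat.le_ceil _).trans ?_
    exact_mod_cast Nat.lt_succ_iff.1 h4

/-- Take `s` in the open set close to `x` and consider the cells around `s` level by level: the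
first covered one is selected. Its level exceeds `N`, since at level `N` and below the cell of `s`
also contains `x`, which no covered cell can. It is therefore short and close to `x`. -/
theorem exists_selected_near (hI : ∀ i, IsOpen (I i)) {x : ℝ} (hx0 : 0 ≤ x) (hx : x ∉ ⋃ i, I i)
    (hcl : x ∈ closure ((⋃ i, I i) ∩ Set.Ioo 0 1)) {ε : ℝ} (hε : 0 < ε) :
    ∃ n k, k < 2 ^ n ∧ selected I n k ∧ dyadicCell n k ⊆ Metric.ball x ε := by
  classical
  obtain ⟨N, hN⟩ := exists_pow_lt_of_lt_one (half_pos hε) (by norm_num : (1 / 2 : ℝ) < 1)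
  obtain ⟨s, ⟨hsN, hsx⟩, hsI, hs0, hs1⟩ := mem_closure_iff_nhds.1 hcl _
    (Filter.inter_mem (eventually_mem_dyadicCell_floor N hx0) (Metric.ball_mem_nhds x (half_pos hε)))
  have hxc : x ∈ dyadicCell N ⌊s * 2 ^ N⌋₊ := hsN hs0.le
  have hex : ∃ n, covered I n ⌊s * 2 ^ n⌋₊ := by
    obtain ⟨i, hi⟩ := Set.mem_iUnion.1 hsI
    obtain ⟨δ, hδ, hb⟩ := Metric.isOpen_iff.1 (hI i) s hi
    obtain ⟨m, hm⟩ := exists_pow_lt_of_lt_one hδ (by norm_num : (1 / 2 : ℝ) < 1)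
    refine ⟨m + i + 1, i, by omega, fun y hy => hb ?_⟩
    have h2 := abs_sub_le_of_mem_dyadicCell _ _ hy (mem_dyadicCell_floor (m + i + 1) hs0.le)
    have h3 : ((1 : ℝ) / 2) ^ (m + i + 1) ≤ (1 / 2) ^ m :=
      pow_le_pow_of_le_one (by norm_num) (by norm_num) (by omega)
    rw [Metric.mem_ball, Real.dist_eq]
    linarith
  obtain ⟨n, hn, hmin⟩ : ∃ n, covered I n ⌊s * 2 ^ n⌋₊ ∧ ∀ m < n, ¬ covered I m ⌊s * 2 ^ m⌋₊ :=
    ⟨Nat.find hex, Nat.find_spec hex, fun m hm => Nat.find_min hex hm⟩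
  have hnN : N < n := by
    by_contra hle
    obtain ⟨d, rfl⟩ := Nat.exists_eq_add_of_le (not_lt.1 hle)
    exact hx ((hn.mono (Nat.le_add_right _ _) (dyadicCell_floor_subset n d s)).subset hxc)
  refine ⟨n, ⌊s * 2 ^ n⌋₊, ?_, ⟨hn, ?_⟩, fun y hy => ?_⟩
  · rw [Nat.floor_lt (by positivity)]
    push_cast
    have hp := pow_pos (two_pos : (0 : ℝ) < 2) n
    nlinarith
  · obtain ⟨l, rfl⟩ : ∃ l, n = l + 1 := ⟨n - 1, by omega⟩
    have h := floor_pow_add_div l 1 s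
    rw [pow_one] at h
    rw [h, Nat.add_sub_cancel]
    exact hmin l (Nat.lt_succ_self l)
  · have h2 := abs_sub_le_of_mem_dyadicCell _ _ hy (mem_dyadicCell_floor n hs0.le)
    have h3 : ((1 : ℝ) / 2) ^ n ≤ (1 / 2) ^ N :=
      pow_le_pow_of_le_one (by norm_num) (by norm_num) hnN.le
    rw [Metric.mem_ball] at hsx ⊢
    calc dist y x ≤ dist y s + dist s x := dist_triangle _ _ _
      _ < ε := by rw [Real.dist_eq y s]; linarith

theorem not_forall_abs_deriv_le (hI : ∀ i, IsOpen (I i)) {n k : ℕ} (hk : k < 2 ^ n)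
    (hs : selected I n k) : ∃ y ∈ dyadicCell n k, 1 / 2 < |deriv (bumpSeries (selected I)) y| := by
  by_contra! hcon
  -- The bump rises from `0` at `c - w` to `w` at its centre `c`, a mean slope of `1`.
  set w : ℝ := ((2 ^ (4 * n + 2) : ℕ) : ℝ)⁻¹ with hw
  set c : ℝ := ((2 * k + 1 : ℕ) : ℝ) * ((2 ^ (n + 1) : ℕ) : ℝ)⁻¹ with hc
  have hw0 : 0 < w := by rw [hw]; positivity
  have hc1 : c ∈ openCell n k := (mem_openCell_of_abs n k (by rw [sub_self, abs_zero]; exact hw0.le)).1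
  have hc2 : c - w ∈ openCell n k :=
    (mem_openCell_of_abs n k (by rw [sub_sub_cancel_left, abs_neg, abs_of_pos hw0])).1
  have h1 : bumpSeries (selected I) c = w := by
    rw [bumpSeries_eq_cellBump hs hk hc1]; exact cellBump_mid n k
  have h2 : bumpSeries (selected I) (c - w) = 0 := by
    rw [bumpSeries_eq_cellBump hs hk hc2]
    exact cellBump_eq_zero n k (by rw [sub_sub_cancel_left, abs_neg, abs_of_pos hw0])
  have h := (convex_Icc ((k : ℝ) / 2 ^ n) (((k : ℝ) + 1) / 2 ^ n)).norm_image_sub_le_of_norm_deriv_le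
    (fun y _ => differentiableAt_bumpSeries hI y) hcon (openCell_subset n k hc2) (openCell_subset n k hc1)
  rw [h1, h2, sub_zero, sub_sub_cancel, Real.norm_eq_abs, abs_of_pos hw0] at h
  linarith

end Selected

/-! ### Computability of the bump series -/

section Computability

variable {A : Set ℕ}

theorem primrec_bumpShape : Primrec (bumpShape : ℚ → ℚ) := by
  have h : Primrec fun v : ℚ => max 0 (1 - v * v) :=
    RatCode.primrec_rat_max.comp (.const 0)
      (RatCode.primrec_rat_sub.comp (.const 1) (RatCode.primrec_rat_mul.comp .id .id))
  exact (RatCode.primrec_rat_mul.comp h h).of_eq fun v => by simp only [bumpShape, sq]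

theorem primrec_cellBump : Primrec fun x : (ℚ × ℕ) × ℕ => (cellBump x.1.2 x.2 x.1.1 : ℚ) := by
  have ht : Primrec fun x : (ℚ × ℕ) × ℕ => x.1.1 := Primrec.fst.comp .fst
  have hn : Primrec fun x : (ℚ × ℕ) × ℕ => x.1.2 := Primrec.snd.comp .fst
  have hM : Primrec fun x : (ℚ × ℕ) × ℕ => 2 ^ (4 * x.1.2 + 2) :=
    RatCode.primrec_two_pow.comp (Primrec.nat_add.comp (Primrec.nat_mul.comp (.const 4) hn) (.const 2))
  have hc : Primrec fun x : (ℚ × ℕ) × ℕ =>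
      ((2 * x.2 + 1 : ℕ) : ℚ) * ((2 ^ (x.1.2 + 1) : ℕ) : ℚ)⁻¹ :=
    RatCode.primrec_rat_mul.comp
      (RatCode.primrec_rat_natCast.comp (Primrec.nat_add.comp (Primrec.nat_mul.comp (.const 2) .snd) (.const 1)))
      (RatCode.primrec_rat_invNat.comp (RatCode.primrec_two_pow.comp (Primrec.nat_add.comp hn (.const 1))))
  exact RatCode.primrec_rat_mul.comp (RatCode.primrec_rat_invNat.comp hM)
    (primrec_bumpShape.comp (RatCode.primrec_rat_mul.comp (RatCode.primrec_rat_sub.comp ht hc)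
      (RatCode.primrec_rat_natCast.comp hM)))

theorem relComp_bumpLayer {S : ℕ → ℕ → Prop} (hS : RelDec A fun x : ℕ × ℕ => S x.1 x.2) :
    RelComp A fun x : ℚ × ℕ => (bumpLayer S x.2 x.1 : ℚ) := by
  classical
  have hh : RelComp A fun z : (ℚ × ℕ) × ℕ => if S z.1.2 z.2 then (cellBump z.1.2 z.2 z.1.1 : ℚ) else 0 :=
    .ite (hS.comp ((RelComp.snd.comp .fst).pair .snd)) (.of_primrec primrec_cellBump) (.const 0)
  have hp : RelComp A fun x : ℚ × ℕ => 2 ^ x.2 := .of_primrec (RatCode.primrec_two_pow.comp .snd)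
  have h := RelComp.sum hp hh
  refine h.of_eq fun x => ?_
  unfold bumpLayer
  refine Finset.sum_congr rfl fun k _ => ?_
  split_ifs <;> rfl

theorem relComp_bumpSum {S : ℕ → ℕ → Prop} (hS : RelDec A fun x : ℕ × ℕ => S x.1 x.2) :
    RelComp A fun x : ℚ × ℕ => (bumpSum S x.2 x.1 : ℚ) := by
  have hp : RelComp A fun x : ℚ × ℕ => x.2 := .snd
  have hs : RelComp A fun z : (ℚ × ℕ) × ℕ => (z.1.1, z.2) := (RelComp.fst.comp .fst).pair .snd
  have h2 := (relComp_bumpLayer hS).comp hs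
  have h := RelComp.sum hp h2
  exact h.of_eq fun x => by simp only [bumpSum]

/-- An interval `(a, b)` is enumerated for `(q, r)` once some partial sum at `a` lies in `(q, r)`
with margin `err`, which adds the tail bound to the Lipschitz bound over the length `b - a`. -/
theorem isComputableFunIn_bumpSeries {S : ℕ → ℕ → Prop} (hS : RelDec A fun x : ℕ × ℕ => S x.1 x.2) :
    IsComputableFunIn A fun t => bumpSeries S t := by
  let err : ((ℚ × ℚ) × (ℚ × ℚ)) × ℕ → ℚ := fun z =>
    ((2 ^ z.2 : ℕ) : ℚ)⁻¹ + ((2 ^ z.2 : ℕ) : ℚ) * (4 * (z.1.2.2 - z.1.2.1))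
  let p : ((ℚ × ℚ) × (ℚ × ℚ)) × ℕ → Prop := fun z =>
    z.1.1.1 + err z < bumpSum S z.2 z.1.2.1 ∧ bumpSum S z.2 z.1.2.1 + err z < z.1.1.2
  have hp : RelDec A p := by
    have hu : RelComp A fun z : ((ℚ × ℚ) × (ℚ × ℚ)) × ℕ => z.1.1 := RelComp.fst.comp .fst
    have hab : RelComp A fun z : ((ℚ × ℚ) × (ℚ × ℚ)) × ℕ => z.1.2 := RelComp.snd.comp .fst
    have ha : RelComp A fun z : ((ℚ × ℚ) × (ℚ × ℚ)) × ℕ => z.1.2.1 := RelComp.fst.comp hab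
    have hb : RelComp A fun z : ((ℚ × ℚ) × (ℚ × ℚ)) × ℕ => z.1.2.2 := RelComp.snd.comp hab
    have hpow : Primrec fun z : ((ℚ × ℚ) × (ℚ × ℚ)) × ℕ => 2 ^ z.2 :=
      RatCode.primrec_two_pow.comp .snd
    have herr : RelComp A err :=
      .comp₂ RatCode.primrec_rat_add (.of_primrec (RatCode.primrec_rat_invNat.comp hpow))
        (.comp₂ RatCode.primrec_rat_mul (.of_primrec (RatCode.primrec_rat_natCast.comp hpow))
          (.comp₂ RatCode.primrec_rat_mul (.const 4) (.comp₂ RatCode.primrec_rat_sub hb ha)))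
    have hs : RelComp A fun z : ((ℚ × ℚ) × (ℚ × ℚ)) × ℕ => (bumpSum S z.2 z.1.2.1 : ℚ) :=
      (relComp_bumpSum hS).comp (f := fun x : ℚ × ℕ => (bumpSum S x.2 x.1 : ℚ))
        (g := fun z : ((ℚ × ℚ) × (ℚ × ℚ)) × ℕ => (z.1.2.1, z.2)) (ha.pair .snd)
    exact (RelDec.rat_lt (.comp₂ RatCode.primrec_rat_add (RelComp.fst.comp hu) herr) hs).and
      (.rat_lt (.comp₂ RatCode.primrec_rat_add hs herr) (RelComp.snd.comp hu))
  obtain ⟨s, hs, es⟩ := (RelEnum.of_relDec hp).exists_of.exists_index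
  refine ⟨s, hs, fun q r => ?_⟩
  ext t
  simp only [sigmaClass, ← RatCode.encode_rat_pair, es, Set.mem_preimage, Set.mem_Ioo, Set.mem_ofPred_eq]
  have key : ∀ (N : ℕ) (a : ℚ), |bumpSeries S t - bumpSum S N (a : ℝ)| ≤
      (2 ^ N : ℝ)⁻¹ + 2 ^ N * (4 * |(t : ℝ) - a|) := fun N a => by
    refine (abs_sub_le _ (bumpSum S N (t : ℝ)) _).trans (add_le_add ?_ (abs_bumpSum_sub_le S N t a))
    exact (abs_bumpSeries_sub_bumpSum_le S N t).trans_eq (by rw [one_div_pow, one_div])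
  constructor
  · rintro ⟨hq, hr⟩
    obtain ⟨η, hη, hηq, hηr⟩ : ∃ η : ℝ, 0 < η ∧ η ≤ bumpSeries S t - q ∧ η ≤ r - bumpSeries S t :=
      ⟨min (bumpSeries S t - q) (r - bumpSeries S t), lt_min (by linarith) (by linarith),
        min_le_left _ _, min_le_right _ _⟩
    obtain ⟨N, hN⟩ := exists_pow_lt_of_lt_one (show 0 < η / 4 by linarith) (by norm_num : (1 / 2 : ℝ) < 1)
    rw [one_div_pow, one_div] at hN
    have hp2 : (0 : ℝ) < 2 ^ N := by positivity
    -- With `b - a < 2 * ρ` the Lipschitz term is at most `η / 4`, like the tail. The error enters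
    -- twice, in the approximation of the series and in the margin, so the total stays below `η`.
    set ρ : ℝ := η / 4 / (2 ^ N * 8) with hρ
    have hρ0 : 0 < ρ := by positivity
    obtain ⟨a, ha1, ha2⟩ := exists_rat_btwn (show (t : ℝ) - ρ < t by linarith)
    obtain ⟨b, hb1, hb2⟩ := exists_rat_btwn (show (t : ℝ) < t + ρ by linarith)
    have e1 : (2 : ℝ) ^ N * (4 * (b - a)) ≤ η / 4 := by
      have : (2 : ℝ) ^ N * (4 * (2 * ρ)) = η / 4 := by rw [hρ]; field_simp; norm_num
      rw [← this]
      gcongr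
      linarith
    have e2 : (2 : ℝ) ^ N * (4 * |(t : ℝ) - a|) ≤ η / 4 := by
      refine le_trans ?_ e1
      rw [abs_of_pos (by linarith)]
      gcongr
    have hk := abs_le.1 (key N a)
    refine ⟨a, b, ⟨N, ?_, ?_⟩, ha2, hb1⟩
    · rw [← Rat.cast_lt (K := ℝ), cast_bumpSum]
      simp only [err]
      push_cast
      linarith [hk.1]
    · rw [← Rat.cast_lt (K := ℝ), Rat.cast_add, cast_bumpSum]
      simp only [err]
      push_cast
      linarith [hk.2]
  · rintro ⟨a, b, ⟨N, h1, h2⟩, hat, htb⟩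
    rw [← Rat.cast_lt (K := ℝ), cast_bumpSum] at h1
    rw [← Rat.cast_lt (K := ℝ), Rat.cast_add, cast_bumpSum] at h2
    simp only [err] at h1 h2
    push_cast at h1 h2
    have hk := abs_le.1 (key N a)
    have e : (2 : ℝ) ^ N * (4 * |(t : ℝ) - a|) ≤ 2 ^ N * (4 * (b - a)) := by
      rw [abs_of_pos (by linarith)]
      gcongr
    constructor <;> linarith [hk.1, hk.2]

/-- An enumerable predicate is enumerated by a computable sequence of candidates. -/
theorem RelEnum.exists_seq {β : Type*} [Primcodable β] [Inhabited β] {p : β → Prop} (hp : RelEnum A p) :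
    ∃ (u : ℕ → β) (v : ℕ → Prop), RelComp A u ∧ RelDec A v ∧ ∀ b, p b ↔ ∃ i, v i ∧ u i = b := by
  obtain ⟨R, hR, e⟩ := hp
  have hu : RelComp A fun i : ℕ => ((Encodable.decode i.unpair.1 : Option β).getD default) :=
    .of_primrec (Primrec.option_getD.comp (Primrec.decode.comp (Primrec.fst.comp Primrec.unpair)) (.const _))
  refine ⟨_, fun i => R ((Encodable.decode i.unpair.1 : Option β).getD default, i.unpair.2), hu,
    hR.comp (hu.pair (.of_primrec (Primrec.snd.comp Primrec.unpair))), fun b => ?_⟩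
  rw [e]
  constructor
  · rintro ⟨m, hm⟩
    exact ⟨Nat.pair (Encodable.encode b) m, by simpa using hm, by simp⟩
  · rintro ⟨i, h, rfl⟩
    exact ⟨_, h⟩

/-- Containment of a closed cell in a rational interval is a comparison of ends, and the restriction
to the first `n` intervals makes the search finite, although the open set itself is only enumerable.
-/
theorem relDec_selected {u : ℕ → ℚ × ℚ} {v : ℕ → Prop} (hu : RelComp A u) (hv : RelDec A v) :
    RelDec A fun x : ℕ × ℕ =>
      selected (fun i => {t : ℝ | v i ∧ ((u i).1 : ℝ) < t ∧ t < (u i).2}) x.1 x.2 := by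
  have hc : RelDec A fun x : ℕ × ℕ =>
      covered (fun i => {t : ℝ | v i ∧ ((u i).1 : ℝ) < t ∧ t < (u i).2}) x.1 x.2 := by
    have hn : Primrec fun z : (ℕ × ℕ) × ℕ => z.1.1 := Primrec.fst.comp .fst
    have hk : Primrec fun z : (ℕ × ℕ) × ℕ => z.1.2 := Primrec.snd.comp .fst
    have hi : Primrec fun z : (ℕ × ℕ) × ℕ => ((2 ^ z.1.1 : ℕ) : ℚ)⁻¹ :=
      RatCode.primrec_rat_invNat.comp (RatCode.primrec_two_pow.comp hn)
    have hl : Primrec fun z : (ℕ × ℕ) × ℕ => (z.1.2 : ℚ) * ((2 ^ z.1.1 : ℕ) : ℚ)⁻¹ :=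
      RatCode.primrec_rat_mul.comp (RatCode.primrec_rat_natCast.comp hk) hi
    have hr : Primrec fun z : (ℕ × ℕ) × ℕ => ((z.1.2 + 1 : ℕ) : ℚ) * ((2 ^ z.1.1 : ℕ) : ℚ)⁻¹ :=
      RatCode.primrec_rat_mul.comp (RatCode.primrec_rat_natCast.comp (Primrec.succ.comp hk)) hi
    have hu' : RelComp A fun z : (ℕ × ℕ) × ℕ => u z.2 := hu.comp .snd
    refine (RelDec.exists_lt (f := fun x : ℕ × ℕ => x.1) .fst ((hv.comp .snd).and
      ((RelDec.rat_lt (RelComp.fst.comp hu') (.of_primrec hl)).and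
        (.rat_lt (.of_primrec hr) (RelComp.snd.comp hu'))))).of_eq fun ⟨n, k⟩ => ?_
    refine exists_congr fun i => and_congr_right fun _ => ?_
    have hle : (k : ℝ) / 2 ^ n ≤ ((k : ℝ) + 1) / 2 ^ n := by gcongr; linarith
    rw [← Rat.cast_lt (K := ℝ), ← Rat.cast_lt (K := ℝ)]
    push_cast
    rw [← div_eq_mul_inv, ← div_eq_mul_inv]
    constructor
    · rintro ⟨h1, h2, h3⟩ t ⟨ht1, ht2⟩
      exact ⟨h1, h2.trans_le ht1, ht2.trans_lt h3⟩
    -- Both ends belong to the closed cell, so the containment can be read off there.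
    · intro h
      have h1 := h ⟨le_rfl, hle⟩
      exact ⟨h1.1, h1.2.1, (h ⟨hle, le_rfl⟩).2.2⟩
  refine hc.and (hc.comp (f := fun x : ℕ × ℕ => (x.1 - 1, x.2 / 2)) ?_).not
  exact .of_primrec ((Primrec.nat_sub.comp .fst (.const 1)).pair (Primrec.nat_div.comp .snd (.const 2)))

end Computability

/-! ### Discontinuous derivatives at boundary points, and the equivalence. -/

/-- At a boundary point of a `Π⁰₁` class, some computable differentiable function has a
discontinuous derivative. -/
theorem IsPiClass.exists_not_continuousAt_deriv {A : Set ℕ} {V : Set unitInterval}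
    (hV : IsPiClass A V) {x : unitInterval} (hx : x ∈ V \ interior V) :
    ∃ f f' : unitInterval → ℝ, IsComputableFunIn A f ∧ HasDerivOnUnit f f' ∧ ¬ ContinuousAt f' x := by
  obtain ⟨e, he⟩ := hV
  have hE : RelEnum A fun y : ℚ × ℚ => ratPairCode y.1 y.2 ∈ ceSet A e :=
    (RelEnum.mem_ceSet A).comp (f := fun y : ℚ × ℚ => (ratPairCode y.1 y.2, e))
      (RelComp.pair (.of_primrec Primrec.encode) (.const e))
  obtain ⟨u, v, hu, hv, huv⟩ := hE.exists_seq
  -- A candidate that fails the test `v i` contributes the empty set.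
  let I : ℕ → Set ℝ := fun i => {t : ℝ | v i ∧ ((u i).1 : ℝ) < t ∧ t < (u i).2}
  have hI : ∀ i, IsOpen (I i) := fun i =>
    isOpen_const.and ((isOpen_lt (by fun_prop) (by fun_prop)).and (isOpen_lt (by fun_prop) (by fun_prop)))
  have hmem : ∀ t : unitInterval, t ∈ Vᶜ ↔ (t : ℝ) ∈ ⋃ i, I i := by
    intro t
    rw [he, Set.mem_iUnion]
    constructor
    · rintro ⟨a, b, hab, ht⟩
      obtain ⟨i, hi, hab'⟩ := (huv (a, b)).1 hab
      exact ⟨i, hi, by rw [hab']; exact ht⟩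
    · rintro ⟨i, hi, ht⟩
      exact ⟨_, _, (huv (u i)).2 ⟨i, hi, rfl⟩, ht⟩
  have hxI : (x : ℝ) ∉ ⋃ i, I i := fun h => (hmem x).2 h hx.1
  -- The boundary is taken in `[0,1]`, but the selected cell is found from a point of `(0,1)`; a
  -- real open set that meets `[0,1]` also meets `(0,1)`.
  have hcl : (x : ℝ) ∈ closure ((⋃ i, I i) ∩ Set.Ioo 0 1) := by
    rw [mem_closure_iff]
    intro O hO hxO
    have hxc : x ∈ closure Vᶜ := by rw [closure_compl]; exact hx.2
    obtain ⟨y, hyO, hyV⟩ := mem_closure_iff.1 hxc _ (hO.preimage continuous_subtype_val) hxO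
    have hy : (y : ℝ) ∈ closure (Set.Ioo (0 : ℝ) 1) := by
      rw [closure_Ioo zero_ne_one]; exact y.2
    obtain ⟨z, ⟨hz1, hz2⟩, hz3⟩ := mem_closure_iff.1 hy _ (hO.inter (isOpen_iUnion hI)) ⟨hyO, (hmem y).1 hyV⟩
    exact ⟨z, hz1, hz2, hz3⟩
  refine ⟨fun t => bumpSeries (selected I) t, fun t => deriv (bumpSeries (selected I)) t,
    isComputableFunIn_bumpSeries (relDec_selected hu hv), fun t => ?_, fun hcont => ?_⟩
  · refine (differentiableAt_bumpSeries hI t).hasDerivAt.hasDerivWithinAt.congr (fun y hy => ?_) ?_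
    · exact Set.IccExtend_of_mem _ _ hy
    · exact Set.IccExtend_of_mem _ _ t.2
  · have h0 : deriv (bumpSeries (selected I)) x = 0 := (hasDerivAt_bumpSeries_zero hxI).deriv
    obtain ⟨ε, hε, hb⟩ := Metric.continuousAt_iff.1 hcont (1 / 2) (by norm_num)
    obtain ⟨n, k, hk, hs, hsub⟩ := exists_selected_near hI x.2.1 hxI hcl hε
    obtain ⟨y, hy, hy2⟩ := not_forall_abs_deriv_le hI hk hs
    have hp := pow_pos (two_pos : (0 : ℝ) < 2) n
    have hy01 : y ∈ Set.Icc (0 : ℝ) 1 := by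
      refine ⟨le_trans (by positivity) hy.1, hy.2.trans ?_⟩
      rw [div_le_one hp]
      exact_mod_cast hk
    have := hb (x := ⟨y, hy01⟩) (hsub hy)
    rw [h0, Real.dist_eq, sub_zero] at this
    linarith

theorem isOneGenericIn_iff {A : Set ℕ} {x : unitInterval} : IsOneGenericIn A x ↔
    ∀ f f' : unitInterval → ℝ, IsComputableFunIn A f → HasDerivOnUnit f f' → ContinuousAt f' x := by
  refine ⟨fun hx f f' hf hd => hx.continuousAt_deriv hf hd, fun h V hV hx => ?_⟩
  obtain ⟨f, f', hf, hd, hc⟩ := hV.exists_not_continuousAt_deriv hx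
  exact hc (h f f' hf hd)

theorem mainTheorem6 :
    (∀ (A : Set ℕ) (x : unitInterval),
      IsOneGenericIn A x ↔
        ∀ f f' : unitInterval → ℝ,
          IsComputableFunIn A f → HasDerivOnUnit f f' → ContinuousAt f' x) ∧
    (∀ (n : ℕ), 1 ≤ n → ∀ x : unitInterval,
      IsNGeneric n x ↔
        ∀ f f' : unitInterval → ℝ,
          IsComputableFunIn (jumpEmpty (n - 1)) f → HasDerivOnUnit f f' → ContinuousAt f' x) :=
  -- `IsNGeneric n` unfolds to `IsOneGenericIn (jumpEmpty (n - 1))`.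
  ⟨fun _ _ => isOneGenericIn_iff, fun _ _ _ => isOneGenericIn_iff⟩
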